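/- Let $N\ge 1$, $1<p<\infty$, let $\Omega\subset\mathbb R^N$ be a bounded open set with Lipschitz boundary, and let $F$ be a strictly convex norm on $\mathbb R^N$, i.e. a norm whose closed unit ball $\{\xi: F(\xi)\le 1\}$ is strictly convex. Write $\partial F(\xi)=\{\delta\in\mathbb R^N : \delta\cdot(\eta-\xi)\le F(\eta)-F(\xi)\ \text{for all }\eta\in\mathbb R^N\}$. Boundary values of functions in $W^{1,p}(\Omega)$ are understood in the sense of traces, inequalities and equalities on $\partial\Omega$ holding $\mathcal H^{N-1}$-a.e.; $W^{1,p}_0(\Omega)$ is the closure of $C_c^\infty(\Omega)$ in $W^{1,p}(\Omega)$. (1) (Comparison) Let $u_1,u_2\in W^{1,p}(\Omega)$ and let $z_1,z_2:\Omega\to\mathbb R^N$ be measurable with $z_i\in\partial F(\nabla u_i)$ a.e. in $\Omega$. Suppose that $$\operatorname{div}\big(F^{p-1}(\nabla u_1)z_1\big)\ \ge\ \operatorname{div}\big(F^{p-1}(\nabla u_2)z_2\big)\quad\text{in }\Omega$$ in the weak sense, that is, $$\int_\Omega F^{p-1}(\nabla u_1)\,z_1\cdot\nabla w\ \le\ \int_\Omega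 F^{p-1}(\nabla u_2)\,z_2\cdot\nabla w\qquad\text{for all } w\in W^{1,p}_0(\Omega),\ w\ge 0,$$ and that $u_1\le u_2$ on $\partial\Omega$. Then $u_1\le u_2$ a.e. in $\Omega$. (2) (Uniqueness) Let $\varphi$ be the trace on $\partial\Omega$ of some function in $W^{1,p}(\Omega)$ (equivalently, $\varphi\in W^{1-\frac1p,p}(\partial\Omega)$ when $N\ge2$), and let $\mathcal F_{\Omega,\varphi}:L^p(\Omega)\to[0,+\infty]$ be given by $\mathcal F_{\Omega,\varphi}(u)=\int_\Omega F^p(\nabla u)$ if $u\in W^{1,p}(\Omega)$ and $u=\varphi$ on $\partial\Omega$, and $\mathcal F_{\Omega,\varphi}(u)=+\infty$ otherwise. Then any two minimizers of $\mathcal F_{\Omega,\varphi}$ coincide a.e. in $\Omega$. Likewise, any two functions $u\in W^{1,p}(\Omega)$ with $u=\varphi$ on $\partial\Omega$ for which there is a measurable $z\in\partial F(\nabla u)$ with $\int_\Omega F^{p-1}(\nabla u)\,z\cdot\nabla w=0$ for all $w\in W^{1,p}_0(\Omega)$ coincide a.e. in $\Omega$. -/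

import Mathlib

open MeasureTheory Filter Topology
open scoped ENNReal ContDiff RealInnerProductSpace

noncomputable section

namespace AnisotropicComparison

/-- `Ω` has Lipschitz boundary: near each boundary point, `Ω` is, in the direction of some unit
vector `e`, the strict epigraph of a Lipschitz function of the component orthogonal to `e`. -/
def HasLipschitzBoundary {N : ℕ} (Ω : Set (EuclideanSpace ℝ (Fin N))) : Prop :=
  ∀ x₀ ∈ frontier Ω, ∃ (e : EuclideanSpace ℝ (Fin N)) (r : ℝ) (K : NNReal)
    (γ : EuclideanSpace ℝ (Fin N) → ℝ),
    ‖e‖ = 1 ∧ 0 < r ∧ LipschitzWith K γ ∧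
      ∀ x ∈ Metric.ball x₀ r, (x ∈ Ω ↔ γ (x - ⟪e, x⟫ • e) < ⟪e, x⟫)

/-- Test functions: smooth with compact support contained in `Ω`. -/
def IsTestFunction {N : ℕ} (Ω : Set (EuclideanSpace ℝ (Fin N)))
    (ψ : EuclideanSpace ℝ (Fin N) → ℝ) : Prop :=
  ContDiff ℝ ∞ ψ ∧ HasCompactSupport ψ ∧ tsupport ψ ⊆ Ω

/-- The locally integrable field `G` is the weak gradient of `u` in `Ω`. -/
def HasWeakGradient {N : ℕ} (Ω : Set (EuclideanSpace ℝ (Fin N)))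
    (u : EuclideanSpace ℝ (Fin N) → ℝ)
    (G : EuclideanSpace ℝ (Fin N) → EuclideanSpace ℝ (Fin N)) : Prop :=
  LocallyIntegrableOn u Ω ∧ LocallyIntegrableOn G Ω ∧
    ∀ ψ, IsTestFunction Ω ψ → ∀ v : EuclideanSpace ℝ (Fin N),
      ∫ x in Ω, u x * fderiv ℝ ψ x v = - ∫ x in Ω, ⟪G x, v⟫ * ψ x

open scoped Classical in
/-- The weak gradient of `u` in `Ω` (unique up to null sets), and `0` if there is none. -/
def weakGrad {N : ℕ} (Ω : Set (EuclideanSpace ℝ (Fin N)))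
    (u : EuclideanSpace ℝ (Fin N) → ℝ) :
    EuclideanSpace ℝ (Fin N) → EuclideanSpace ℝ (Fin N) :=
  if h : ∃ G, HasWeakGradient Ω u G then h.choose else 0

/-- `u ∈ W^{1,p}(Ω)`. -/
def MemW1p {N : ℕ} (Ω : Set (EuclideanSpace ℝ (Fin N))) (p : ℝ)
    (u : EuclideanSpace ℝ (Fin N) → ℝ) : Prop :=
  MemLp u (ENNReal.ofReal p) (volume.restrict Ω) ∧
    (∃ G, HasWeakGradient Ω u G) ∧
    MemLp (weakGrad Ω u) (ENNReal.ofReal p) (volume.restrict Ω)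

/-- `ψ n → u` in `W^{1,p}(Ω)`, for differentiable functions `ψ n`. -/
def TendstoW1p {N : ℕ} (Ω : Set (EuclideanSpace ℝ (Fin N))) (p : ℝ)
    (ψ : ℕ → EuclideanSpace ℝ (Fin N) → ℝ) (u : EuclideanSpace ℝ (Fin N) → ℝ) : Prop :=
  Tendsto (fun n => eLpNorm (fun x => ψ n x - u x) (ENNReal.ofReal p) (volume.restrict Ω))
    atTop (𝓝 0) ∧
  Tendsto (fun n => eLpNorm (fun x => gradient (ψ n) x - weakGrad Ω u x) (ENNReal.ofReal p)
    (volume.restrict Ω)) atTop (𝓝 0)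

/-- `w ∈ W_0^{1,p}(Ω)`, the closure of the test functions in `W^{1,p}(Ω)`. -/
def MemW01p {N : ℕ} (Ω : Set (EuclideanSpace ℝ (Fin N))) (p : ℝ)
    (w : EuclideanSpace ℝ (Fin N) → ℝ) : Prop :=
  MemW1p Ω p w ∧ ∃ ψ : ℕ → EuclideanSpace ℝ (Fin N) → ℝ,
    (∀ n, IsTestFunction Ω (ψ n)) ∧ TendstoW1p Ω p ψ w

/-- The surface measure on `∂Ω`: the `(N-1)`-dimensional Hausdorff measure restricted to `∂Ω`. -/
def surfaceMeasure {N : ℕ} (Ω : Set (EuclideanSpace ℝ (Fin N))) :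
    Measure (EuclideanSpace ℝ (Fin N)) :=
  (Measure.hausdorffMeasure ((N : ℝ) - 1)).restrict (frontier Ω)

/-- `g ∈ L^p(∂Ω)` is the trace of `u ∈ W^{1,p}(Ω)`: the trace operator is the continuous extension
to `W^{1,p}(Ω)`, with values in `L^p(∂Ω)`, of the restriction of `C¹` functions to `∂Ω`. -/
def HasTrace {N : ℕ} (Ω : Set (EuclideanSpace ℝ (Fin N))) (p : ℝ)
    (u g : EuclideanSpace ℝ (Fin N) → ℝ) : Prop :=
  MemW1p Ω p u ∧ MemLp g (ENNReal.ofReal p) (surfaceMeasure Ω) ∧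
  ∃ ψ : ℕ → EuclideanSpace ℝ (Fin N) → ℝ,
    (∀ n, ContDiff ℝ 1 (ψ n)) ∧ TendstoW1p Ω p ψ u ∧
    Tendsto (fun n => eLpNorm (fun x => ψ n x - g x) (ENNReal.ofReal p) (surfaceMeasure Ω))
      atTop (𝓝 0)

/-- `u₁ ≤ u₂` on `∂Ω` in the sense of traces. -/
def LeOnBoundary {N : ℕ} (Ω : Set (EuclideanSpace ℝ (Fin N))) (p : ℝ)
    (u₁ u₂ : EuclideanSpace ℝ (Fin N) → ℝ) : Prop :=
  ∃ g₁ g₂, HasTrace Ω p u₁ g₁ ∧ HasTrace Ω p u₂ g₂ ∧ ∀ᵐ x ∂surfaceMeasure Ω, g₁ x ≤ g₂ x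

/-- `F` is a strictly convex norm: it vanishes only at `0`, and its closed unit ball is strictly
convex. -/
def IsStrictlyConvexNorm {N : ℕ} (F : Seminorm ℝ (EuclideanSpace ℝ (Fin N))) : Prop :=
  (∀ ξ, F ξ = 0 → ξ = 0) ∧ StrictConvex ℝ {ξ | F ξ ≤ 1}

/-- The subdifferential `∂f(ξ)` of a function on `ℝ^N`. -/
def subdifferential {N : ℕ} (f : EuclideanSpace ℝ (Fin N) → ℝ)
    (ξ : EuclideanSpace ℝ (Fin N)) : Set (EuclideanSpace ℝ (Fin N)) :=
  {δ | ∀ η, ⟪δ, η - ξ⟫ ≤ f η - f ξ}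

/-- `z` is a (measurable) selection `z ∈ ∂F(∇u)` almost everywhere in `Ω`. -/
def IsSelection {N : ℕ} (Ω : Set (EuclideanSpace ℝ (Fin N)))
    (F : Seminorm ℝ (EuclideanSpace ℝ (Fin N))) (u : EuclideanSpace ℝ (Fin N) → ℝ)
    (z : EuclideanSpace ℝ (Fin N) → EuclideanSpace ℝ (Fin N)) : Prop :=
  AEStronglyMeasurable z (volume.restrict Ω) ∧
    ∀ᵐ x ∂(volume.restrict Ω), z x ∈ subdifferential F (weakGrad Ω u x)

/-- The field `F^{p-1}(∇u) z`. -/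
def flux {N : ℕ} (Ω : Set (EuclideanSpace ℝ (Fin N))) (p : ℝ)
    (F : Seminorm ℝ (EuclideanSpace ℝ (Fin N))) (u : EuclideanSpace ℝ (Fin N) → ℝ)
    (z : EuclideanSpace ℝ (Fin N) → EuclideanSpace ℝ (Fin N)) :
    EuclideanSpace ℝ (Fin N) → EuclideanSpace ℝ (Fin N) :=
  fun x => F (weakGrad Ω u x) ^ (p - 1) • z x

/-- `div A₁ ≥ div A₂` in `Ω` in the weak sense, tested against nonnegative `w ∈ W_0^{1,p}(Ω)`. -/
def WeakDivGE {N : ℕ} (Ω : Set (EuclideanSpace ℝ (Fin N))) (p : ℝ)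
    (A₁ A₂ : EuclideanSpace ℝ (Fin N) → EuclideanSpace ℝ (Fin N)) : Prop :=
  ∀ w, MemW01p Ω p w → (∀ᵐ x ∂(volume.restrict Ω), 0 ≤ w x) →
    ∫ x in Ω, ⟪A₁ x, weakGrad Ω w x⟫ ≤ ∫ x in Ω, ⟪A₂ x, weakGrad Ω w x⟫

open scoped Classical in
/-- The energy `∫_Ω F^p(∇u)` if `u ∈ W^{1,p}(Ω)` and `u = φ` on `∂Ω`, and `+∞` otherwise. -/
def energy {N : ℕ} (Ω : Set (EuclideanSpace ℝ (Fin N))) (p : ℝ)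
    (F : Seminorm ℝ (EuclideanSpace ℝ (Fin N))) (φ u : EuclideanSpace ℝ (Fin N) → ℝ) : ℝ≥0∞ :=
  if HasTrace Ω p u φ then ∫⁻ x in Ω, ENNReal.ofReal (F (weakGrad Ω u x) ^ p) else ⊤

/-- `u` minimizes the energy with boundary datum `φ` over `L^p(Ω)`. -/
def IsMinimizer {N : ℕ} (Ω : Set (EuclideanSpace ℝ (Fin N))) (p : ℝ)
    (F : Seminorm ℝ (EuclideanSpace ℝ (Fin N))) (φ u : EuclideanSpace ℝ (Fin N) → ℝ) : Prop :=
  MemLp u (ENNReal.ofReal p) (volume.restrict Ω) ∧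
    ∀ w, MemLp w (ENNReal.ofReal p) (volume.restrict Ω) →
      energy Ω p F φ u ≤ energy Ω p F φ w

/-- `u` is a weak solution of `div (F^{p-1}(∇u) z) = 0` in `Ω`, `u = φ` on `∂Ω`, for some
`z ∈ ∂F(∇u)`. -/
def IsWeakSolution {N : ℕ} (Ω : Set (EuclideanSpace ℝ (Fin N))) (p : ℝ)
    (F : Seminorm ℝ (EuclideanSpace ℝ (Fin N))) (φ u : EuclideanSpace ℝ (Fin N) → ℝ) : Prop :=
  HasTrace Ω p u φ ∧ ∃ z, IsSelection Ω F u z ∧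
    ∀ w, MemW01p Ω p w → ∫ x in Ω, ⟪flux Ω p F u z x, weakGrad Ω w x⟫ = 0

end AnisotropicComparison

end

noncomputable section

namespace AnisotropicComparison

/-! Comparison comes from testing both fluxes with `ramp (u₁ - u₂)`, a C¹ substitute for the
positive part. The difference of the two sides is the integral of `rampDeriv (u₁ - u₂)` times `⟪A₁ -
A₂, ∇u₁ - ∇u₂⟫`, with `Aᵢ = F^{p-1}(∇uᵢ) zᵢ`, and it is at most zero. By
`IsStrictlyConvexNorm.flux_monotone` the integrand is nonnegative whatever subgradients are
selected, and the inner product vanishes only if the gradients agree. So `∇u₁ = ∇u₂` a.e. where `u₁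
> u₂`, the test function has zero gradient, and a Poincaré argument
(`MemW01p.nonpos_of_weakGrad_eq_zero`) gives `u₁ ≤ u₂`.

For minimizers, `F^p` is strictly midpoint convex: the power separates vectors of different norm,
the strictly convex ball separates vectors of equal norm. Two minimizers therefore have the same
gradient, and the same Poincaré argument applies in both directions. For weak solutions, comparison
is used twice.

The main labour is to show that the test function lies in `W_0^{1,p}`, given that traces are defined
by C¹ approximation and `W_0^{1,p}` as a closure (`memW01p_of_tendsto`). Approximants are multiplied
by cutoffs `χ` vanishing near the boundary, with `|∇χ| ≤ 1/δ`. The dangerous term `w ∇χ` is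
controlled because a function of zero trace satisfies `‖w‖ ≤ const · δ ‖∇w‖`, with `w` on a boundary
strip of width comparable to `δ` and `∇w` on a wider strip, also of width comparable to `δ`. This
follows from the fundamental theorem of calculus along the chart directions, and the gradient norm
over shrinking strips tends to zero. -/

/-! ### Height over a Lipschitz graph and the volume of layers above it. -/

/-- The height of `x` above the graph of `γ` in the direction `e`. -/
def chartHeight {N : ℕ} (e : EuclideanSpace ℝ (Fin N)) (γ : EuclideanSpace ℝ (Fin N) → ℝ)
    (x : EuclideanSpace ℝ (Fin N)) : ℝ :=
  ⟪e, x⟫ - γ (x - ⟪e, x⟫ • e)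

lemma chartHeight_sub_smul {N : ℕ} {e : EuclideanSpace ℝ (Fin N)} (he : ‖e‖ = 1)
    (γ : EuclideanSpace ℝ (Fin N) → ℝ) (x : EuclideanSpace ℝ (Fin N)) (s : ℝ) :
    chartHeight e γ (x - s • e) = chartHeight e γ x - s := by
  have h1 : ⟪e, x - s • e⟫ = ⟪e, x⟫ - s := by
    rw [inner_sub_right, inner_smul_right, real_inner_self_eq_norm_sq, he]; ring
  have h2 : x - s • e - (⟪e, x⟫ - s) • e = x - ⟪e, x⟫ • e := by
    rw [sub_smul]; abel
  simp only [chartHeight, h1, h2]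
  ring

lemma continuous_chartHeight {N : ℕ} (e : EuclideanSpace ℝ (Fin N))
    {γ : EuclideanSpace ℝ (Fin N) → ℝ} (hγ : Continuous γ) : Continuous (chartHeight e γ) := by
  unfold chartHeight
  fun_prop

lemma chartHeight_sub_le {N : ℕ} {e : EuclideanSpace ℝ (Fin N)} (he : ‖e‖ = 1)
    {γ : EuclideanSpace ℝ (Fin N) → ℝ} {K : NNReal} (hγ : LipschitzWith K γ)
    (x y : EuclideanSpace ℝ (Fin N)) :
    chartHeight e γ x - chartHeight e γ y ≤ (1 + 2 * K) * dist x y := by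
  have h1 : |⟪e, x - y⟫| ≤ dist x y := by
    simpa [he, dist_eq_norm] using abs_real_inner_le_norm e (x - y)
  have h2 : dist (y - ⟪e, y⟫ • e) (x - ⟪e, x⟫ • e) ≤ 2 * dist x y := by
    have : y - ⟪e, y⟫ • e - (x - ⟪e, x⟫ • e) = ⟪e, x - y⟫ • e - (x - y) := by
      rw [inner_sub_right, sub_smul]; abel
    rw [dist_eq_norm, this]
    refine (norm_sub_le _ _).trans ?_
    rw [norm_smul, he, mul_one, Real.norm_eq_abs, ← dist_eq_norm]
    linarith
  have h3 := hγ.dist_le_mul (y - ⟪e, y⟫ • e) (x - ⟪e, x⟫ • e)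
  rw [Real.dist_eq] at h3
  have h4 : (K : ℝ) * dist (y - ⟪e, y⟫ • e) (x - ⟪e, x⟫ • e) ≤ K * (2 * dist x y) := by gcongr
  have h5 := le_abs_self (γ (y - ⟪e, y⟫ • e) - γ (x - ⟪e, x⟫ • e))
  have h6 := le_abs_self ⟪e, x - y⟫
  rw [inner_sub_right] at h6 h1
  simp only [chartHeight]
  linarith

/-- In an orthonormal basis starting with `e`, the layer lies over the projection of `A` to the
orthogonal complement of `e`, and its fibres are contained in intervals of length `L`. The
projection is 1-Lipschitz, so it does not increase Hausdorff measure; Fubini concludes. -/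
lemma volume_graph_layer_le {N : ℕ} {e : EuclideanSpace ℝ (Fin N)} (he : ‖e‖ = 1)
    {γ : EuclideanSpace ℝ (Fin N) → ℝ} (hγ : Continuous γ) (L : ℝ)
    (A : Set (EuclideanSpace ℝ (Fin N))) :
    volume {x | 0 < chartHeight e γ x ∧ chartHeight e γ x < L ∧ x - chartHeight e γ x • e ∈ A}
      ≤ ENNReal.ofReal L * Measure.hausdorffMeasure ((N : ℝ) - 1) A := by
  obtain _ | n := N
  · have : e = 0 := Subsingleton.elim _ _
    simp [this] at he
  obtain ⟨b, hb⟩ := Orthonormal.exists_orthonormalBasis_extension_of_card_eq (𝕜 := ℝ)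
    (E := EuclideanSpace ℝ (Fin (n + 1))) (ι := Fin (n + 1)) (by simp)
    (v := fun _ => e) (s := {0}) (by
      refine ⟨fun i => by simpa using he, fun i j hij => ?_⟩
      exact absurd (Subsingleton.elim i j) hij)
  have hb0 : b 0 = e := hb 0 rfl
  -- The target carries the sup metric, for which the `n`-dimensional Hausdorff measure is exactly
  -- Lebesgue measure, with no normalising constant.
  set P : EuclideanSpace ℝ (Fin (n + 1)) → (Fin n → ℝ) := fun x i => b.repr x i.succ with hP
  have hPlip : LipschitzWith 1 P := by
    refine LipschitzWith.of_dist_le_mul fun x y => ?_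
    rw [NNReal.coe_one, one_mul, dist_pi_le_iff dist_nonneg]
    intro i
    rw [← b.repr.dist_map x y]
    rw [Real.dist_eq, dist_eq_norm]
    simpa using PiLp.norm_apply_le (b.repr x - b.repr y) i.succ
  have hPA : volume (P '' A) ≤ Measure.hausdorffMeasure ((n + 1 : ℕ) - 1 : ℝ) A := by
    have h := (hPlip.lipschitzOnWith (s := A)).hausdorffMeasure_image_le (d := (n : ℝ)) n.cast_nonneg
    have h2 := hausdorffMeasure_pi_real (ι := Fin n)
    rw [Fintype.card_fin] at h2
    rw [h2] at h
    simpa using h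
  set T : EuclideanSpace ℝ (Fin (n + 1)) → ℝ × (Fin n → ℝ) :=
    (MeasurableEquiv.piFinSuccAbove (fun _ => ℝ) 0) ∘ WithLp.ofLp ∘ b.repr with hT
  have hTmp : MeasurePreserving T volume volume :=
    (volume_preserving_piFinSuccAbove (fun _ => ℝ) 0).comp
      ((PiLp.volume_preserving_ofLp (Fin (n + 1))).comp b.measurePreserving_repr)
  have hTx : ∀ x, T x = (⟪e, x⟫, P x) := by
    intro x
    simp only [hT, hP, Function.comp, MeasurableEquiv.piFinSuccAbove_apply]
    refine Prod.ext ?_ ?_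
    · simp [Fin.insertNthEquiv, b.repr_apply_apply, hb0]
    · funext i
      simp [Fin.insertNthEquiv, Fin.tail]
  set q : (Fin n → ℝ) → EuclideanSpace ℝ (Fin (n + 1)) := fun y =>
    b.repr.symm (WithLp.toLp 2 (Fin.cons 0 y)) with hq
  have hqP : ∀ x, q (P x) = x - ⟪e, x⟫ • e := by
    intro x
    apply b.repr.injective
    ext i
    refine Fin.cases ?_ (fun i => ?_) i
    · simp [hq, b.repr_apply_apply, hb0, he]
    · have : ⟪b i.succ, e⟫ = 0 := by
        rw [← hb0]; exact b.orthonormal.2 (Fin.succ_ne_zero i)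
      simp [hq, hP, b.repr_apply_apply, this]
  have hqc : Continuous q := by
    refine b.repr.symm.continuous.comp ((PiLp.continuous_toLp 2 _).comp ?_)
    refine continuous_pi fun i => ?_
    refine Fin.cases ?_ (fun i => ?_) i
    · simpa using continuous_const
    · simpa using continuous_apply i
  -- Neither `A` nor its projection is assumed measurable; the measurable hull has the same measure.
  set Q := toMeasurable volume (P '' A)
  set R : Set (ℝ × (Fin n → ℝ)) := {z | z.2 ∈ Q ∧ γ (q z.2) < z.1 ∧ z.1 < γ (q z.2) + L} with hR
  have hgq : Measurable fun y => γ (q y) := (hγ.comp hqc).measurable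
  have hRm : MeasurableSet R := by
    refine ((measurableSet_toMeasurable _ _).preimage measurable_snd).inter
      ((measurableSet_lt (hgq.comp measurable_snd) measurable_fst).inter
        (measurableSet_lt measurable_fst ((hgq.comp measurable_snd).add_const L)))
  have hsub : {x | 0 < chartHeight e γ x ∧ chartHeight e γ x < L ∧
      x - chartHeight e γ x • e ∈ A} ⊆ T ⁻¹' R := by
    rintro x ⟨h0, h1, h2⟩
    simp only [Set.mem_preimage, hTx, hR, Set.mem_ofPred_eq, hqP]
    simp only [chartHeight] at h0 h1
    refine ⟨subset_toMeasurable _ _ ⟨_, h2, ?_⟩, by linarith, by linarith⟩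
    funext i
    have : ⟪b i.succ, e⟫ = 0 := by
      rw [← hb0]; exact b.orthonormal.2 (Fin.succ_ne_zero i)
    simp [hP, b.repr_apply_apply, inner_sub_right, inner_smul_right, this]
  calc _ ≤ volume (T ⁻¹' R) := measure_mono hsub
    _ = volume R := hTmp.measure_preimage hRm.nullMeasurableSet
    _ = ∫⁻ y, volume ((fun t => (t, y)) ⁻¹' R) := by
        rw [Measure.volume_eq_prod, Measure.prod_apply_symm hRm]
    _ ≤ ∫⁻ y, Q.indicator (fun _ => ENNReal.ofReal L) y := by
        refine lintegral_mono fun y => ?_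
        by_cases hy : y ∈ Q
        · have : (fun t => (t, y)) ⁻¹' R = Set.Ioo (γ (q y)) (γ (q y) + L) := by
            ext t; simp [hR, hy]
          rw [this, Set.indicator_of_mem hy]
          simp
        · have : (fun t => (t, y)) ⁻¹' R = ∅ := by
            ext t; simp [hR, hy]
          simp [this]
    _ = ENNReal.ofReal L * volume (P '' A) := by
        rw [lintegral_indicator_const (measurableSet_toMeasurable _ _), measure_toMeasurable]
    _ ≤ _ := by gcongr

/-! ### `L^p` estimates in a boundary strip. -/

lemma norm_gradient {N : ℕ} (f : EuclideanSpace ℝ (Fin N) → ℝ) (x : EuclideanSpace ℝ (Fin N)) :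
    ‖gradient f x‖ = ‖fderiv ℝ f x‖ := by
  simp [gradient]

lemma continuous_gradient {N : ℕ} {f : EuclideanSpace ℝ (Fin N) → ℝ} (hf : ContDiff ℝ 1 f) :
    Continuous (gradient f) :=
  (InnerProductSpace.toDual ℝ _).symm.continuous.comp (hf.continuous_fderiv one_ne_zero)

/-- The fundamental theorem of calculus on the segment from `x` to `x - h • e`, Hölder on an
interval of length `h` (the factor `h^(p-1)`), and `(a + b)^p ≤ 2^(p-1) (a^p + b^p)`. -/
lemma enorm_rpow_le_segment {N : ℕ} {p : ℝ} (hp : 1 < p) {e : EuclideanSpace ℝ (Fin N)}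
    (he : ‖e‖ = 1) {f : EuclideanSpace ℝ (Fin N) → ℝ} (hf : ContDiff ℝ 1 f)
    (x : EuclideanSpace ℝ (Fin N)) {h : ℝ} (hh : 0 ≤ h) :
    ‖f x‖ₑ ^ p ≤ 2 ^ (p - 1) * (‖f (x - h • e)‖ₑ ^ p +
      ENNReal.ofReal h ^ (p - 1) * ∫⁻ s in Set.Ioo 0 h, ‖gradient f (x - s • e)‖ₑ ^ p) := by
  have hp0 : 0 < p := by linarith
  have hline : Continuous fun s : ℝ => x - s • e := by fun_prop
  have hg : Continuous fun s => gradient f (x - s • e) := (continuous_gradient hf).comp hline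
  have hd : ∀ s ∈ Set.uIcc 0 h, HasDerivAt (fun s : ℝ => f (x - s • e))
      (- ⟪gradient f (x - s • e), e⟫) s := by
    intro s _
    have h1 : HasDerivAt (fun s : ℝ => x - s • e) (-e) s := by
      simpa using ((hasDerivAt_id s).smul_const e).const_sub x
    have h2 := ((hf.differentiable one_ne_zero) (x - s • e)).hasFDerivAt.comp_hasDerivAt s h1
    rw [inner_gradient_left]
    rw [map_neg] at h2
    exact h2
  have hftc := intervalIntegral.integral_eq_sub_of_hasDerivAt hd
    (Continuous.intervalIntegrable (by fun_prop) _ _)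
  have hI : ‖f (x - h • e) - f x‖ₑ ≤ ∫⁻ s in Set.Ioo 0 h, ‖gradient f (x - s • e)‖ₑ := by
    have : f (x - h • e) - f x = ∫ s in (0)..h, - ⟪gradient f (x - s • e), e⟫ := by
      rw [hftc]; simp
    rw [this, intervalIntegral.integral_of_le hh, restrict_Ioo_eq_restrict_Ioc]
    refine (enorm_integral_le_lintegral_enorm _).trans (lintegral_mono fun s => ?_)
    rw [enorm_neg, ← ofReal_norm, ← ofReal_norm]
    apply ENNReal.ofReal_le_ofReal
    simpa [he] using norm_inner_le_norm (𝕜 := ℝ) (gradient f (x - s • e)) e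
  have hJ : (∫⁻ s in Set.Ioo 0 h, ‖gradient f (x - s • e)‖ₑ) ^ p ≤
      ENNReal.ofReal h ^ (p - 1) * ∫⁻ s in Set.Ioo 0 h, ‖gradient f (x - s • e)‖ₑ ^ p := by
    have h1 := eLpNorm'_le_eLpNorm'_mul_rpow_measure_univ (p := 1) (q := p) one_pos hp.le
      (μ := volume.restrict (Set.Ioo 0 h)) hg.aestronglyMeasurable
    simp only [eLpNorm', ENNReal.rpow_one, ne_eq, one_ne_zero, not_false_eq_true, div_self,
      Measure.restrict_apply_univ, Real.volume_Ioo, sub_zero] at h1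
    refine (ENNReal.rpow_le_rpow h1 hp0.le).trans_eq ?_
    rw [ENNReal.mul_rpow_of_nonneg _ _ hp0.le, ← ENNReal.rpow_mul, ← ENNReal.rpow_mul,
      one_div_mul_cancel hp0.ne', ENNReal.rpow_one, mul_comm]
    congr 2
    field_simp
  have htri : ‖f x‖ₑ ≤ ‖f (x - h • e)‖ₑ + ∫⁻ s in Set.Ioo 0 h, ‖gradient f (x - s • e)‖ₑ := by
    calc ‖f x‖ₑ = ‖f (x - h • e) - (f (x - h • e) - f x)‖ₑ := by simp
      _ ≤ _ := enorm_sub_le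
      _ ≤ _ := by gcongr
  calc ‖f x‖ₑ ^ p ≤ _ := ENNReal.rpow_le_rpow htri hp0.le
    _ ≤ _ := ENNReal.rpow_add_le_mul_rpow_add_rpow _ _ hp.le
    _ ≤ _ := by gcongr

/-- The part of `Ω` at distance less than `δ` from the complement. -/
def boundaryStrip {N : ℕ} (Ω : Set (EuclideanSpace ℝ (Fin N))) (δ : ℝ) :
    Set (EuclideanSpace ℝ (Fin N)) :=
  Ω ∩ {x | Metric.infDist x Ωᶜ < δ}

lemma isOpen_boundaryStrip {N : ℕ} {Ω : Set (EuclideanSpace ℝ (Fin N))} (hΩ : IsOpen Ω) (δ : ℝ) :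
    IsOpen (boundaryStrip Ω δ) :=
  hΩ.inter (isOpen_lt (Metric.continuous_infDist_pt _) continuous_const)

lemma boundaryStrip_mono {N : ℕ} (Ω : Set (EuclideanSpace ℝ (Fin N))) {δ δ' : ℝ} (h : δ ≤ δ') :
    boundaryStrip Ω δ ⊆ boundaryStrip Ω δ' :=
  fun _ hx => ⟨hx.1, lt_of_lt_of_le hx.2 h⟩

/-- The segment inequality is integrated over the layer, each segment ending on the graph. The
requirement `r' + L ≤ r` keeps these segments inside the ball where the chart is valid. -/
lemma lintegral_graph_layer_le {N : ℕ} {p : ℝ} (hp : 1 < p)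
    {Ω : Set (EuclideanSpace ℝ (Fin N))} (hΩ : IsOpen Ω)
    {e : EuclideanSpace ℝ (Fin N)} (he : ‖e‖ = 1)
    {γ : EuclideanSpace ℝ (Fin N) → ℝ} (hγ : Continuous γ)
    {x₀ : EuclideanSpace ℝ (Fin N)} {r r' L : ℝ} (hL : 0 < L) (hr : r' + L ≤ r)
    (hchart : ∀ x ∈ Metric.ball x₀ r, (x ∈ Ω ↔ 0 < chartHeight e γ x))
    {f : EuclideanSpace ℝ (Fin N) → ℝ} (hf : ContDiff ℝ 1 f) :
    ∫⁻ x in Metric.ball x₀ r' ∩ {x | 0 < chartHeight e γ x ∧ chartHeight e γ x < L}, ‖f x‖ₑ ^ p ≤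
      2 ^ (p - 1) * (ENNReal.ofReal L * ∫⁻ x, ‖f x‖ₑ ^ p ∂surfaceMeasure Ω +
        ENNReal.ofReal L ^ p * ∫⁻ x in boundaryStrip Ω L, ‖gradient f x‖ₑ ^ p) := by
  have hp0 : 0 < p := by linarith
  have hhc := continuous_chartHeight e hγ
  set h := chartHeight e γ with hh
  have hsub : ∀ x s, h (x - s • e) = h x - s := chartHeight_sub_smul he γ
  set S := Metric.ball x₀ r' ∩ {x | 0 < h x ∧ h x < L} with hS
  set π : EuclideanSpace ℝ (Fin N) → EuclideanSpace ℝ (Fin N) := fun x => x - h x • e with hπ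
  have hπm : Measurable π := by
    have : Continuous π := by fun_prop
    exact this.measurable
  have hseg : ∀ x ∈ S, ∀ s : ℝ, 0 ≤ s → s ≤ h x → x - s • e ∈ Metric.ball x₀ r := by
    intro x hx s hs0 hs1
    have h1 : dist (x - s • e) x = s := by simp [norm_smul, he, abs_of_nonneg hs0]
    have h2 := hx.1
    rw [Metric.mem_ball] at h2 ⊢
    have := dist_triangle (x - s • e) x x₀
    linarith [hx.2.2]
  have hπΩ : ∀ x ∈ S, π x ∉ Ω := by
    intro x hx
    rw [hchart _ (hseg x hx _ hx.2.1.le le_rfl), hsub]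
    simp
  -- The foot `π x` lies outside `Ω` at distance less than `L`, so the open segment stays in the
  -- strip.
  have hsegΩ : ∀ x ∈ S, ∀ s ∈ Set.Ioo 0 (h x), x - s • e ∈ boundaryStrip Ω L := by
    intro x hx s hs
    constructor
    · rw [hchart _ (hseg x hx s hs.1.le hs.2.le), hsub]
      linarith [hs.2]
    · refine (Metric.infDist_le_dist_of_mem (hπΩ x hx)).trans_lt ?_
      have : x - s • e - (x - h x • e) = (h x - s) • e := by rw [sub_smul]; abel
      rw [dist_eq_norm, hπ, this, norm_smul, he, mul_one, Real.norm_eq_abs,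
        abs_of_nonneg (by linarith [hs.2])]
      linarith [hx.2.2, hs.1]
  have hπfr : ∀ x ∈ S, π x ∈ frontier Ω := by
    intro x hx
    rw [hΩ.frontier_eq]
    refine ⟨?_, hπΩ x hx⟩
    have hc : Continuous fun s : ℝ => x - s • e := by fun_prop
    refine mem_closure_of_tendsto (f := fun s : ℝ => x - s • e) (b := 𝓝[<] (h x))
      (hc.tendsto (h x) |>.mono_left nhdsWithin_le_nhds) ?_
    filter_upwards [Ioo_mem_nhdsLT hx.2.1] with s hs using (hsegΩ x hx s hs).1
  -- Projecting along `e` pushes Lebesgue measure on the layer to at most `L` times surface measure;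
  -- this is how boundary values enter.
  have hmap : (volume.restrict S).map π ≤ ENNReal.ofReal L • surfaceMeasure Ω := by
    refine Measure.le_iff.2 fun A hA => ?_
    rw [Measure.map_apply hπm hA, Measure.restrict_apply (hπm hA), Measure.smul_apply,
      surfaceMeasure, Measure.restrict_apply hA, smul_eq_mul]
    refine (measure_mono ?_).trans (volume_graph_layer_le he hγ L (A ∩ frontier Ω))
    rintro x ⟨hxA, hxS⟩
    exact ⟨hxS.2.1, hxS.2.2, hxA, hπfr x hxS⟩
  have hfm : Measurable fun x => ‖f x‖ₑ ^ p := (hf.continuous.measurable.enorm).pow_const _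
  have hgm : Measurable fun x => ‖gradient f x‖ₑ ^ p :=
    ((continuous_gradient hf).measurable.enorm).pow_const _
  have hDm : MeasurableSet (boundaryStrip Ω L) := (isOpen_boundaryStrip hΩ L).measurableSet
  -- Extending by zero lets the integrals run over all `x` and over the fixed interval `(0, L)`.
  -- Fubini and translation invariance then produce the factor `L`.
  set G := (boundaryStrip Ω L).indicator fun x => ‖gradient f x‖ₑ ^ p with hG
  have hGm : Measurable G := hgm.indicator hDm
  have h1 : ∫⁻ x in S, ‖f (π x)‖ₑ ^ p ≤ ENNReal.ofReal L * ∫⁻ x, ‖f x‖ₑ ^ p ∂surfaceMeasure Ω := by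
    rw [← lintegral_map hfm hπm, ← smul_eq_mul, ← lintegral_smul_measure]
    exact lintegral_mono' hmap le_rfl
  have hline : Measurable fun z : EuclideanSpace ℝ (Fin N) × ℝ => z.1 - z.2 • e := by
    have : Continuous fun z : EuclideanSpace ℝ (Fin N) × ℝ => z.1 - z.2 • e := by fun_prop
    exact this.measurable
  have h2 : ∫⁻ x in S, ∫⁻ s in Set.Ioo 0 L, G (x - s • e) ≤
      ENNReal.ofReal L * ∫⁻ x in boundaryStrip Ω L, ‖gradient f x‖ₑ ^ p := by
    calc ∫⁻ x in S, ∫⁻ s in Set.Ioo 0 L, G (x - s • e)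
        ≤ ∫⁻ x, ∫⁻ s in Set.Ioo 0 L, G (x - s • e) := setLIntegral_le_lintegral _ _
      _ = ∫⁻ s in Set.Ioo 0 L, ∫⁻ x, G (x - s • e) :=
          lintegral_lintegral_swap (hGm.comp hline).aemeasurable
      _ = ∫⁻ s in Set.Ioo 0 L, ∫⁻ x, G x := by
          simp_rw [lintegral_sub_right_eq_self]
      _ = _ := by
          rw [setLIntegral_const, hG, lintegral_indicator hDm, Real.volume_Ioo, sub_zero, mul_comm]
  have hLp : ENNReal.ofReal L ^ p = ENNReal.ofReal L ^ (p - 1) * ENNReal.ofReal L := by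
    conv_rhs => rw [← ENNReal.rpow_one (ENNReal.ofReal L), ← ENNReal.rpow_mul, one_mul]
    rw [← ENNReal.rpow_add _ _ (by simpa using hL) ENNReal.ofReal_ne_top]
    simp
  calc ∫⁻ x in S, ‖f x‖ₑ ^ p
      ≤ ∫⁻ x in S, 2 ^ (p - 1) * (‖f (π x)‖ₑ ^ p +
          ENNReal.ofReal L ^ (p - 1) * ∫⁻ s in Set.Ioo 0 L, G (x - s • e)) := by
        refine setLIntegral_mono_ae ?_ (Eventually.of_forall fun x hx => ?_)
        · refine (Measurable.const_mul (Measurable.add (hfm.comp hπm)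
            (Measurable.const_mul ?_ _)) _).aemeasurable
          exact (hGm.comp hline).lintegral_prod_right'
        · refine (enorm_rpow_le_segment hp he hf x hx.2.1.le).trans ?_
          gcongr ?_ * (_ + ?_ * ?_)
          · exact le_rfl
          · gcongr
            exact hx.2.2.le
          · calc ∫⁻ s in Set.Ioo 0 (h x), ‖gradient f (x - s • e)‖ₑ ^ p
                = ∫⁻ s in Set.Ioo 0 (h x), G (x - s • e) := by
                  refine setLIntegral_congr_fun measurableSet_Ioo fun s hs => ?_
                  simp [hG, hsegΩ x hx s hs]
              _ ≤ _ := lintegral_mono_set (Set.Ioo_subset_Ioo_right hx.2.2.le)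
    _ = 2 ^ (p - 1) * ((∫⁻ x in S, ‖f (π x)‖ₑ ^ p) +
          ENNReal.ofReal L ^ (p - 1) * ∫⁻ x in S, ∫⁻ s in Set.Ioo 0 L, G (x - s • e)) := by
        rw [lintegral_const_mul' _ _ (by simp), lintegral_add_left (f := fun x => ‖f (π x)‖ₑ ^ p)
            (hfm.comp hπm),
          lintegral_const_mul' _ _ (by simp [hp.le])]
    _ ≤ _ := by
        rw [hLp, mul_assoc]
        gcongr

/-- Compactness of the boundary leaves finitely many charts. If `x` in the strip is close to some `y
∉ Ω` in the same chart, then `y` has height at most zero, and the Lipschitz bound on the height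
keeps that of `x` below `C * δ`. -/
lemma exists_finite_charts {N : ℕ} {Ω : Set (EuclideanSpace ℝ (Fin N))}
    (hΩb : Bornology.IsBounded Ω) (hne : Ωᶜ.Nonempty) (hΩL : HasLipschitzBoundary Ω) :
    ∃ C δ₀ : ℝ, 1 ≤ C ∧ 0 < δ₀ ∧ ∃ (t : Finset (EuclideanSpace ℝ (Fin N)))
      (e : EuclideanSpace ℝ (Fin N) → EuclideanSpace ℝ (Fin N))
      (γ : EuclideanSpace ℝ (Fin N) → EuclideanSpace ℝ (Fin N) → ℝ)
      (r r' : EuclideanSpace ℝ (Fin N) → ℝ),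
      (∀ i ∈ t, ‖e i‖ = 1 ∧ Continuous (γ i) ∧ r' i + C * δ₀ ≤ r i ∧
        ∀ x ∈ Metric.ball i (r i), (x ∈ Ω ↔ 0 < chartHeight (e i) (γ i) x)) ∧
      ∀ δ, δ ≤ δ₀ → boundaryStrip Ω δ ⊆ ⋃ i ∈ t, Metric.ball i (r' i) ∩
        {x | 0 < chartHeight (e i) (γ i) x ∧ chartHeight (e i) (γ i) x < C * δ} := by
  have hΩL' : ∀ x₀ ∈ frontier Ω, ∃ (e : EuclideanSpace ℝ (Fin N)) (r : ℝ) (K : NNReal)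
      (γ : EuclideanSpace ℝ (Fin N) → ℝ), ‖e‖ = 1 ∧ 0 < r ∧ LipschitzWith K γ ∧
      ∀ x ∈ Metric.ball x₀ r, (x ∈ Ω ↔ 0 < chartHeight e γ x) := by
    simpa only [chartHeight, sub_pos, HasLipschitzBoundary] using hΩL
  choose! e r K γ he hr hγ hc using hΩL'
  have hfc : IsCompact (frontier Ω) :=
    hΩb.isCompact_closure.of_isClosed_subset isClosed_frontier frontier_subset_closure
  obtain ⟨t, ht, hcov⟩ := hfc.elim_nhds_subcover (fun x => Metric.ball x (r x / 2))
    (fun x hx => Metric.ball_mem_nhds x (half_pos (hr x hx)))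
  set U := ⋃ x ∈ t, Metric.ball x (r x / 2)
  have hUo : IsOpen U := isOpen_biUnion fun _ _ => Metric.isOpen_ball
  have hD : IsCompact (closure Ω \ U) := hΩb.isCompact_closure.diff hUo
  have hDΩ : closure Ω \ U ⊆ interior Ω := fun x hx => by
    by_contra h
    exact hx.2 (hcov ⟨hx.1, h⟩)
  obtain ⟨ρ, hρ, hDρ⟩ := hD.exists_thickening_subset_open isOpen_interior hDΩ
  -- A sum rather than a maximum: it dominates every `1 + 2 * K i` and gives `1 ≤ C` even when there
  -- are no charts.
  set C : ℝ := 1 + ∑ i ∈ t, 2 * (K i : ℝ) with hC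
  have hCi : ∀ i ∈ t, 1 + 2 * (K i : ℝ) ≤ C := fun i hi => by
    have := Finset.single_le_sum (f := fun i => 2 * (K i : ℝ)) (fun _ _ => by positivity) hi
    simpa [hC] using this
  have hC1 : 1 ≤ C := by
    have : 0 ≤ ∑ i ∈ t, 2 * (K i : ℝ) := Finset.sum_nonneg fun _ _ => by positivity
    linarith
  -- Points of `Ω` outside the charts are at distance at least `ρ` from the complement. The bound `C
  -- * δ < r i / 2` leaves room for the segments and, since `1 ≤ C`, for the nearby point `y ∉ Ω`.
  have hev : ∀ᶠ δ in 𝓝[>] (0 : ℝ), 0 < δ ∧ δ < ρ ∧ ∀ i ∈ t, C * δ < r i / 2 := by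
    refine Eventually.and self_mem_nhdsWithin (.and ?_ ((Filter.eventually_all_finset t).2 fun i hi => ?_))
    · exact nhdsWithin_le_nhds (gt_mem_nhds hρ)
    · have h1 : Tendsto (fun δ : ℝ => C * δ) (𝓝[>] 0) (𝓝 (C * 0)) :=
        ((continuous_const.mul continuous_id).tendsto 0).mono_left nhdsWithin_le_nhds
      rw [mul_zero] at h1
      exact h1.eventually_lt_const (half_pos (hr i (ht i hi)))
  obtain ⟨δ₀, hδ₀, hδρ, hδr⟩ := hev.exists
  refine ⟨C, δ₀, hC1, hδ₀, t, e, γ, r, fun i => r i / 2, fun i hi => ⟨he i (ht i hi),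
    (hγ i (ht i hi)).continuous, by linarith [hδr i hi], hc i (ht i hi)⟩, ?_⟩
  rintro δ hδ x ⟨hxΩ, hx⟩
  obtain ⟨y, hyΩ, hxy⟩ := (Metric.infDist_lt_iff hne).1 hx
  have hxU : x ∈ U := by
    by_contra h
    refine hyΩ (interior_subset (hDρ ?_))
    rw [Metric.mem_thickening_iff]
    exact ⟨x, ⟨subset_closure hxΩ, h⟩, by rw [dist_comm]; linarith⟩
  obtain ⟨i, hi, hxi⟩ := Set.mem_iUnion₂.1 hxU
  have hri := hδr i hi
  have hδC : δ₀ ≤ C * δ₀ := le_mul_of_one_le_left hδ₀.le hC1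
  rw [Metric.mem_ball] at hxi
  have hyi : y ∈ Metric.ball i (r i) := by
    rw [Metric.mem_ball]
    have := dist_triangle_left y i x
    linarith
  have hxi' : x ∈ Metric.ball i (r i) := by
    rw [Metric.mem_ball]
    linarith [hr i (ht i hi)]
  have hy0 : chartHeight (e i) (γ i) y ≤ 0 := not_lt.1 fun h => hyΩ ((hc i (ht i hi) y hyi).2 h)
  refine Set.mem_iUnion₂.2 ⟨i, hi, hxi, (hc i (ht i hi) x hxi').1 hxΩ, ?_⟩
  have h1 := chartHeight_sub_le (he i (ht i hi)) (hγ i (ht i hi)) x y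
  have h2 : (1 + 2 * (K i : ℝ)) * dist x y ≤ C * dist x y := by
    gcongr
    exact hCi i hi
  have h3 : C * dist x y < C * δ := by gcongr
  linarith

lemma restrict_biUnion_finset_le {α ι : Type*} [MeasurableSpace α] (μ : Measure α) (t : Finset ι)
    (s : ι → Set α) : μ.restrict (⋃ i ∈ t, s i) ≤ ∑ i ∈ t, μ.restrict (s i) := by
  refine Measure.le_iff.2 fun A hA => ?_
  rw [Measure.restrict_apply hA, Set.inter_iUnion₂, Measure.finsetSum_apply]
  refine (measure_biUnion_finset_le t _).trans_eq ?_
  simp [Measure.restrict_apply hA]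

/-- The constant `M` depends neither on `δ` nor on `f`. What matters later is the full power of `δ`
in front of the gradient, which offsets the `1/δ` from a cutoff. -/
lemma eLpNorm_boundaryStrip_le {N : ℕ} {p : ℝ} (hp : 1 < p)
    {Ω : Set (EuclideanSpace ℝ (Fin N))} (hΩ : IsOpen Ω) (hΩb : Bornology.IsBounded Ω)
    (hne : Ωᶜ.Nonempty) (hΩL : HasLipschitzBoundary Ω) :
    ∃ (M : ℝ≥0∞) (C δ₀ : ℝ), M ≠ ⊤ ∧ 1 ≤ C ∧ 0 < δ₀ ∧
      ∀ δ, 0 < δ → δ ≤ δ₀ → ∀ f : EuclideanSpace ℝ (Fin N) → ℝ, ContDiff ℝ 1 f →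
        eLpNorm f (ENNReal.ofReal p) (volume.restrict (boundaryStrip Ω δ)) ≤
          M * (ENNReal.ofReal (C * δ) ^ (1 / p) *
              eLpNorm f (ENNReal.ofReal p) (surfaceMeasure Ω) +
            ENNReal.ofReal (C * δ) * eLpNorm (gradient f) (ENNReal.ofReal p)
              (volume.restrict (boundaryStrip Ω (C * δ)))) := by
  have hp0 : 0 < p := by linarith
  obtain ⟨C, δ₀, hC, hδ₀, t, e, γ, r, r', hchart, hcov⟩ := exists_finite_charts hΩb hne hΩL
  refine ⟨(t.card * 2 ^ (p - 1)) ^ (1 / p), C, δ₀, ?_, hC, hδ₀, fun δ hδ hδ' f hf => ?_⟩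
  · refine ENNReal.rpow_ne_top_of_nonneg (by positivity) (ENNReal.mul_ne_top (by simp) ?_)
    exact ENNReal.rpow_ne_top_of_nonneg (by linarith) (by simp)
  have key : ∫⁻ x in boundaryStrip Ω δ, ‖f x‖ₑ ^ p ≤ t.card * 2 ^ (p - 1) *
      (ENNReal.ofReal (C * δ) * (∫⁻ x, ‖f x‖ₑ ^ p ∂surfaceMeasure Ω) +
        ENNReal.ofReal (C * δ) ^ p *
          ∫⁻ x in boundaryStrip Ω (C * δ), ‖gradient f x‖ₑ ^ p) := by
    calc ∫⁻ x in boundaryStrip Ω δ, ‖f x‖ₑ ^ p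
        ≤ ∫⁻ x in ⋃ i ∈ t, Metric.ball i (r' i) ∩
          {x | 0 < chartHeight (e i) (γ i) x ∧ chartHeight (e i) (γ i) x < C * δ}, ‖f x‖ₑ ^ p :=
          lintegral_mono_set (hcov δ hδ')
      _ ≤ ∑ i ∈ t, ∫⁻ x in Metric.ball i (r' i) ∩
          {x | 0 < chartHeight (e i) (γ i) x ∧ chartHeight (e i) (γ i) x < C * δ}, ‖f x‖ₑ ^ p := by
          rw [← lintegral_finsetSum_measure]
          exact lintegral_mono' (restrict_biUnion_finset_le _ _ _) le_rfl
      _ ≤ ∑ i ∈ t, 2 ^ (p - 1) *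
          (ENNReal.ofReal (C * δ) * (∫⁻ x, ‖f x‖ₑ ^ p ∂surfaceMeasure Ω) +
          ENNReal.ofReal (C * δ) ^ p *
          ∫⁻ x in boundaryStrip Ω (C * δ), ‖gradient f x‖ₑ ^ p) := by
          refine Finset.sum_le_sum fun i hi => ?_
          obtain ⟨h1, h2, h3, h4⟩ := hchart i hi
          refine lintegral_graph_layer_le hp hΩ h1 h2 (by positivity) ?_ h4 hf
          have : C * δ ≤ C * δ₀ := by gcongr
          linarith
      _ = _ := by
          rw [Finset.sum_const, nsmul_eq_mul, mul_assoc]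
  have hpp : ENNReal.ofReal p ≠ 0 := by simpa using hp0
  simp only [eLpNorm_eq_lintegral_rpow_enorm_toReal hpp ENNReal.ofReal_ne_top,
    ENNReal.toReal_ofReal hp0.le]
  refine (ENNReal.rpow_le_rpow key (by positivity)).trans ?_
  rw [ENNReal.mul_rpow_of_nonneg _ _ (by positivity : 0 ≤ 1 / p)]
  gcongr
  refine (ENNReal.rpow_add_le_add_rpow _ _ (by positivity) ?_).trans_eq ?_
  · rw [div_le_one hp0]; exact hp.le
  · rw [ENNReal.mul_rpow_of_nonneg _ _ (by positivity),
      ENNReal.mul_rpow_of_nonneg _ _ (by positivity), ← ENNReal.rpow_mul, mul_one_div_cancel hp0.ne',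
      ENNReal.rpow_one]

lemma tendsto_volume_boundaryStrip {N : ℕ} {Ω : Set (EuclideanSpace ℝ (Fin N))} (hΩ : IsOpen Ω)
    (hΩb : Bornology.IsBounded Ω) (hne : Ωᶜ.Nonempty) {δ : ℕ → ℝ} (hδ : Antitone δ)
    (hδ0 : Tendsto δ atTop (𝓝 0)) :
    Tendsto (fun n => volume (boundaryStrip Ω (δ n))) atTop (𝓝 0) := by
  have h := tendsto_measure_iInter_atTop (μ := volume) (s := fun n => boundaryStrip Ω (δ n))
    (fun n => (isOpen_boundaryStrip hΩ _).measurableSet.nullMeasurableSet)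
    (fun m n hmn => boundaryStrip_mono Ω (hδ hmn))
    ⟨0, ((measure_mono Set.inter_subset_left).trans_lt hΩb.measure_lt_top).ne⟩
  have he : ⋂ n, boundaryStrip Ω (δ n) = ∅ := by
    rw [Set.eq_empty_iff_forall_notMem]
    intro x hx
    rw [Set.mem_iInter] at hx
    have h1 : Metric.infDist x Ωᶜ ≤ 0 := ge_of_tendsto' hδ0 fun n => (hx n).2.le
    have h2 := (hΩ.isClosed_compl.notMem_iff_infDist_pos hne).1 (not_not.2 (hx 0).1)
    linarith
  rwa [he, measure_empty] at h

/-- Absolute continuity of the integral; the strips decrease to the empty set because `Ω` is open.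
-/
lemma tendsto_eLpNorm_boundaryStrip {N : ℕ} {p : ℝ} (hp : 1 < p)
    {Ω : Set (EuclideanSpace ℝ (Fin N))} (hΩ : IsOpen Ω)
    (hΩb : Bornology.IsBounded Ω) (hne : Ωᶜ.Nonempty)
    {H : EuclideanSpace ℝ (Fin N) → EuclideanSpace ℝ (Fin N)}
    (hH : MemLp H (ENNReal.ofReal p) (volume.restrict Ω))
    {δ : ℕ → ℝ} (hδ : Antitone δ) (hδ0 : Tendsto δ atTop (𝓝 0)) :
    Tendsto (fun n => eLpNorm H (ENNReal.ofReal p) (volume.restrict (boundaryStrip Ω (δ n))))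
      atTop (𝓝 0) := by
  have hp0 : 0 < p := by linarith
  have hpp : ENNReal.ofReal p ≠ 0 := by simpa using hp0
  have h1 := hH.2
  rw [eLpNorm_lt_top_iff_lintegral_rpow_enorm_lt_top hpp ENNReal.ofReal_ne_top,
    ENNReal.toReal_ofReal hp0.le] at h1
  have h2 : Tendsto (volume.restrict Ω ∘ fun n => boundaryStrip Ω (δ n)) atTop (𝓝 0) := by
    refine tendsto_of_tendsto_of_tendsto_of_le_of_le tendsto_const_nhds
      (tendsto_volume_boundaryStrip hΩ hΩb hne hδ hδ0) (fun _ => zero_le) fun n => ?_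
    exact Measure.restrict_apply_le _ _
  have h3 := tendsto_setLIntegral_zero h1.ne h2
  have h4 := h3.ennrpow_const (1 / p)
  rw [ENNReal.zero_rpow_of_pos (by positivity)] at h4
  refine h4.congr fun n => ?_
  rw [eLpNorm_eq_lintegral_rpow_enorm_toReal hpp ENNReal.ofReal_ne_top,
    ENNReal.toReal_ofReal hp0.le, Measure.restrict_restrict_of_subset (s := boundaryStrip Ω (δ n)) (t := Ω) Set.inter_subset_left]

/-! ### Weak gradients and limits of C¹ functions. -/

lemma IsTestFunction.continuous {N : ℕ} {Ω : Set (EuclideanSpace ℝ (Fin N))}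
    {ψ : EuclideanSpace ℝ (Fin N) → ℝ} (hψ : IsTestFunction Ω ψ) : Continuous ψ :=
  hψ.1.continuous

lemma IsTestFunction.contDiff_one {N : ℕ} {Ω : Set (EuclideanSpace ℝ (Fin N))}
    {ψ : EuclideanSpace ℝ (Fin N) → ℝ} (hψ : IsTestFunction Ω ψ) : ContDiff ℝ 1 ψ :=
  hψ.1.of_le (by exact_mod_cast le_top)

lemma exists_norm_le_of_isBounded {N : ℕ} {E : Type*} [NormedAddCommGroup E]
    {Ω : Set (EuclideanSpace ℝ (Fin N))} (hΩb : Bornology.IsBounded Ω)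
    {f : EuclideanSpace ℝ (Fin N) → E} (hf : Continuous f) : ∃ C, ∀ x ∈ Ω, ‖f x‖ ≤ C := by
  obtain ⟨C, hC⟩ := hΩb.isCompact_closure.exists_bound_of_continuousOn hf.continuousOn
  exact ⟨C, fun x hx => hC x (subset_closure hx)⟩

lemma isFiniteMeasure_restrict_of_isBounded {N : ℕ} {Ω : Set (EuclideanSpace ℝ (Fin N))}
    (hΩb : Bornology.IsBounded Ω) : IsFiniteMeasure (volume.restrict Ω) :=
  ⟨by simpa using hΩb.measure_lt_top⟩

lemma memLp_restrict_of_continuous {N : ℕ} {E : Type*} [NormedAddCommGroup E]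
    {Ω : Set (EuclideanSpace ℝ (Fin N))} (hΩ : IsOpen Ω) (hΩb : Bornology.IsBounded Ω)
    {f : EuclideanSpace ℝ (Fin N) → E} (hf : Continuous f) (P : ℝ≥0∞) :
    MemLp f P (volume.restrict Ω) := by
  have := isFiniteMeasure_restrict_of_isBounded hΩb
  obtain ⟨C, hC⟩ := exists_norm_le_of_isBounded hΩb hf
  exact MemLp.of_bound hf.aestronglyMeasurable C
    ((ae_restrict_iff' hΩ.measurableSet).2 (Eventually.of_forall hC))

lemma integrable_smul_test {N : ℕ} {E : Type*} [NormedAddCommGroup E] [NormedSpace ℝ E]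
    {Ω : Set (EuclideanSpace ℝ (Fin N))} {G : EuclideanSpace ℝ (Fin N) → E}
    (hG : LocallyIntegrableOn G Ω) {ψ : EuclideanSpace ℝ (Fin N) → ℝ} (hψ : IsTestFunction Ω ψ) :
    Integrable (fun x => ψ x • G x) := by
  have hK : IsCompact (tsupport ψ) := hψ.2.1
  have h1 : IntegrableOn G (tsupport ψ) := hG.integrableOn_compact_subset hψ.2.2 hK
  have h2 : IntegrableOn (fun x => ψ x • G x) (tsupport ψ) :=
    h1.continuousOn_smul hψ.continuous.continuousOn hK
  refine (integrableOn_iff_integrable_of_support_subset fun x hx => ?_).1 h2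
  refine subset_tsupport _ fun h => hx ?_
  simp [h]

/-- The fundamental lemma of the calculus of variations, applied to `G₁ - G₂` after pairing with
each fixed vector `v`. -/
lemma HasWeakGradient.ae_eq {N : ℕ} {Ω : Set (EuclideanSpace ℝ (Fin N))} (hΩ : IsOpen Ω)
    {u : EuclideanSpace ℝ (Fin N) → ℝ}
    {G₁ G₂ : EuclideanSpace ℝ (Fin N) → EuclideanSpace ℝ (Fin N)}
    (h₁ : HasWeakGradient Ω u G₁) (h₂ : HasWeakGradient Ω u G₂) :
    G₁ =ᵐ[volume.restrict Ω] G₂ := by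
  have h := hΩ.ae_eq_zero_of_integral_contDiff_smul_eq_zero (h₁.2.1.sub h₂.2.1) (μ := volume) ?_
  · filter_upwards [(ae_restrict_iff' hΩ.measurableSet).2 h] with x hx
    simpa [sub_eq_zero] using hx
  intro ψ h1 h2 h3
  have hψ : IsTestFunction Ω ψ := ⟨h1, h2, h3⟩
  have i₁ := integrable_smul_test h₁.2.1 hψ
  have i₂ := integrable_smul_test h₂.2.1 hψ
  have key : ∀ G : EuclideanSpace ℝ (Fin N) → EuclideanSpace ℝ (Fin N), ∀ v,
      Integrable (fun x => ψ x • G x) → ∫ x in Ω, ⟪G x, v⟫ * ψ x = ⟪∫ x, ψ x • G x, v⟫ := by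
    intro G v i
    rw [real_inner_comm, ← integral_inner i v, setIntegral_eq_integral_of_forall_compl_eq_zero]
    · refine integral_congr_ae (Eventually.of_forall fun x => ?_)
      simp only [inner_smul_right, real_inner_comm]
      ring
    · intro x hx
      rw [image_eq_zero_of_notMem_tsupport fun h => hx (h3 h), mul_zero]
  simp only [Pi.sub_apply, smul_sub]
  rw [integral_sub i₁ i₂]
  refine ext_inner_right ℝ fun v => ?_
  rw [inner_sub_left, ← key G₁ v i₁, ← key G₂ v i₂, inner_zero_left, sub_eq_zero]
  have e₁ := h₁.2.2 ψ hψ v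
  have e₂ := h₂.2.2 ψ hψ v
  linarith

/-- Identifies the representative picked by choice in `weakGrad` with any explicitly computed weak
gradient. -/
lemma HasWeakGradient.weakGrad_ae_eq {N : ℕ} {Ω : Set (EuclideanSpace ℝ (Fin N))} (hΩ : IsOpen Ω)
    {u : EuclideanSpace ℝ (Fin N) → ℝ}
    {G : EuclideanSpace ℝ (Fin N) → EuclideanSpace ℝ (Fin N)}
    (h : HasWeakGradient Ω u G) : weakGrad Ω u =ᵐ[volume.restrict Ω] G := by
  have h' : ∃ G, HasWeakGradient Ω u G := ⟨G, h⟩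
  rw [weakGrad, dif_pos h']
  exact h'.choose_spec.ae_eq hΩ h

/-- On a finite measure space `L^p` convergence implies `L^1` convergence, and `g` is bounded. -/
lemma tendsto_integral_inner {α E : Type*} [MeasurableSpace α] {μ : Measure α} [IsFiniteMeasure μ]
    [NormedAddCommGroup E] [InnerProductSpace ℝ E] {P : ℝ≥0∞} (hP : 1 ≤ P)
    {F : ℕ → α → E} {f g : α → E} (hF : ∀ n, MemLp (F n) P μ) (hf : MemLp f P μ)
    (hFf : Tendsto (fun n => eLpNorm (fun x => F n x - f x) P μ) atTop (𝓝 0))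
    (hg : AEStronglyMeasurable g μ) {C : ℝ} (hC : ∀ᵐ x ∂μ, ‖g x‖ ≤ C) :
    Tendsto (fun n => ∫ x, ⟪F n x, g x⟫ ∂μ) atTop (𝓝 (∫ x, ⟪f x, g x⟫ ∂μ)) := by
  have hint : ∀ {h : α → E}, MemLp h P μ → Integrable (fun x => ⟪h x, g x⟫) μ := by
    intro h hh
    refine ((hh.integrable hP).norm.mul_const C).mono
      (hh.aestronglyMeasurable.inner hg) ?_
    filter_upwards [hC] with x hx
    refine (norm_inner_le_norm _ _).trans ?_
    rw [norm_mul, norm_norm]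
    gcongr
    exact hx.trans (le_abs_self C)
  refine tendsto_integral_of_L1' _ (hint hf).aestronglyMeasurable (Eventually.of_forall fun n => hint (hF n)) ?_
  have hbound : ∀ n, eLpNorm ((fun x => ⟪F n x, g x⟫) - fun x => ⟪f x, g x⟫) 1 μ ≤
      ENNReal.ofReal C * (eLpNorm (fun x => F n x - f x) P μ *
        μ Set.univ ^ (1 / (1 : ℝ≥0∞).toReal - 1 / P.toReal)) := by
    intro n
    have h1 : eLpNorm ((fun x => ⟪F n x, g x⟫) - fun x => ⟪f x, g x⟫) 1 μ ≤
        ENNReal.ofReal C * eLpNorm (fun x => F n x - f x) 1 μ := by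
      refine eLpNorm_le_mul_eLpNorm_of_ae_le_mul ?_ 1
      filter_upwards [hC] with x hx
      simp only [Pi.sub_apply, ← inner_sub_left]
      refine (norm_inner_le_norm _ _).trans ?_
      rw [mul_comm]
      gcongr
    refine h1.trans ?_
    gcongr
    exact eLpNorm_le_eLpNorm_mul_rpow_measure_univ hP
      ((hF n).aestronglyMeasurable.sub hf.aestronglyMeasurable)
  refine tendsto_of_tendsto_of_tendsto_of_le_of_le tendsto_const_nhds ?_ (fun _ => zero_le) hbound
  have hfin : μ Set.univ ^ (1 / (1 : ℝ≥0∞).toReal - 1 / P.toReal) ≠ ⊤ := by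
    refine ENNReal.rpow_ne_top_of_nonneg ?_ (measure_ne_top _ _)
    rcases eq_or_ne P ⊤ with rfl | hPt
    · simp
    · have : 1 ≤ P.toReal := by simpa using ENNReal.toReal_mono hPt hP
      simp only [ENNReal.toReal_one, div_one, sub_nonneg]
      exact (div_le_one (by linarith)).2 this
  have h2 := ENNReal.Tendsto.mul_const (b := μ Set.univ ^ (1 / (1 : ℝ≥0∞).toReal - 1 / P.toReal))
    hFf (Or.inr hfin)
  have h3 := ENNReal.Tendsto.const_mul (a := ENNReal.ofReal C) h2 (Or.inr ENNReal.ofReal_ne_top)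
  simpa using h3

lemma integral_mul_fderiv_test {N : ℕ} {Ω : Set (EuclideanSpace ℝ (Fin N))}
    {f ψ : EuclideanSpace ℝ (Fin N) → ℝ} (hf : ContDiff ℝ 1 f) (hψ : IsTestFunction Ω ψ)
    (v : EuclideanSpace ℝ (Fin N)) :
    ∫ x in Ω, f x * fderiv ℝ ψ x v = - ∫ x in Ω, ⟪gradient f x, v⟫ * ψ x := by
  have hsub := hψ.2.2
  have hsub' : tsupport (fderiv ℝ ψ) ⊆ Ω := (tsupport_fderiv_subset ℝ).trans hsub
  rw [setIntegral_eq_integral_of_forall_compl_eq_zero,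
    setIntegral_eq_integral_of_forall_compl_eq_zero]
  · simp only [inner_gradient_left]
    have hψ1 := hψ.contDiff_one
    have hf' : Continuous fun x => fderiv ℝ f x v :=
      (hf.continuous_fderiv one_ne_zero).clm_apply continuous_const
    have hψ' : Continuous fun x => fderiv ℝ ψ x v :=
      (hψ1.continuous_fderiv one_ne_zero).clm_apply continuous_const
    have hψs : HasCompactSupport fun x => fderiv ℝ ψ x v := hψ.2.1.fderiv_apply ℝ v
    refine integral_mul_fderiv_eq_neg_fderiv_mul_of_integrable ?_ ?_ ?_
      (fun x _ => hf.differentiable one_ne_zero x) (fun x _ => hψ1.differentiable one_ne_zero x)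
    · exact (hf'.mul hψ.continuous).integrable_of_hasCompactSupport hψ.2.1.mul_left
    · exact (hf.continuous.mul hψ').integrable_of_hasCompactSupport hψs.mul_left
    · exact (hf.continuous.mul hψ.continuous).integrable_of_hasCompactSupport hψ.2.1.mul_left
  · intro x hx
    rw [image_eq_zero_of_notMem_tsupport fun h => hx (hsub h), mul_zero]
  · intro x hx
    rw [image_eq_zero_of_notMem_tsupport fun h => hx (hsub' h)]
    simp

/-- A limit of `C¹` functions in the Sobolev norm is weakly differentiable. -/
lemma hasWeakGradient_of_tendsto {N : ℕ} {p : ℝ} (hp : 1 < p)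
    {Ω : Set (EuclideanSpace ℝ (Fin N))} (hΩ : IsOpen Ω) (hΩb : Bornology.IsBounded Ω)
    {w : EuclideanSpace ℝ (Fin N) → ℝ} {H : EuclideanSpace ℝ (Fin N) → EuclideanSpace ℝ (Fin N)}
    {f : ℕ → EuclideanSpace ℝ (Fin N) → ℝ}
    (hw : MemLp w (ENNReal.ofReal p) (volume.restrict Ω))
    (hH : MemLp H (ENNReal.ofReal p) (volume.restrict Ω))
    (hf : ∀ n, ContDiff ℝ 1 (f n))
    (hfw : Tendsto (fun n => eLpNorm (fun x => f n x - w x) (ENNReal.ofReal p)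
      (volume.restrict Ω)) atTop (𝓝 0))
    (hfH : Tendsto (fun n => eLpNorm (fun x => gradient (f n) x - H x) (ENNReal.ofReal p)
      (volume.restrict Ω)) atTop (𝓝 0)) :
    HasWeakGradient Ω w H := by
  have := isFiniteMeasure_restrict_of_isBounded hΩb
  have hP : 1 ≤ ENNReal.ofReal p := by simpa using hp.le
  have hwi : IntegrableOn w Ω := hw.integrable hP
  have hHi : IntegrableOn H Ω := hH.integrable hP
  refine ⟨hwi.locallyIntegrableOn, hHi.locallyIntegrableOn, fun ψ hψ v => ?_⟩
  have hψ' : Continuous fun x => fderiv ℝ ψ x v :=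
    (hψ.contDiff_one.continuous_fderiv one_ne_zero).clm_apply continuous_const
  obtain ⟨C₁, hC₁⟩ := exists_norm_le_of_isBounded hΩb hψ'
  have hψv : Continuous fun x => ψ x • v := hψ.continuous.smul continuous_const
  obtain ⟨C₂, hC₂⟩ := exists_norm_le_of_isBounded hΩb hψv
  have t₁ := tendsto_integral_inner hP
    (fun n => memLp_restrict_of_continuous hΩ hΩb (hf n).continuous _) hw hfw
    hψ'.aestronglyMeasurable ((ae_restrict_iff' hΩ.measurableSet).2 (Eventually.of_forall hC₁))
  have t₂ := tendsto_integral_inner hP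
    (fun n => memLp_restrict_of_continuous hΩ hΩb (continuous_gradient (hf n)) _) hH hfH
    hψv.aestronglyMeasurable ((ae_restrict_iff' hΩ.measurableSet).2 (Eventually.of_forall hC₂))
  have e₁ : ∀ a b : ℝ, ⟪a, b⟫ = a * b := fun a b => by simp [mul_comm]
  have e₂ : ∀ (a : EuclideanSpace ℝ (Fin N)) (c : ℝ), ⟪a, c • v⟫ = ⟪a, v⟫ * c := fun a c => by
    rw [inner_smul_right, mul_comm]
  simp only [e₁] at t₁
  simp only [e₂] at t₂
  refine tendsto_nhds_unique t₁ (t₂.neg.congr fun n => ?_)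
  exact (integral_mul_fderiv_test (hf n) hψ v).symm

lemma memW1p_of_hasWeakGradient {N : ℕ} {p : ℝ} {Ω : Set (EuclideanSpace ℝ (Fin N))}
    (hΩ : IsOpen Ω) {w : EuclideanSpace ℝ (Fin N) → ℝ}
    {H : EuclideanSpace ℝ (Fin N) → EuclideanSpace ℝ (Fin N)}
    (hw : MemLp w (ENNReal.ofReal p) (volume.restrict Ω))
    (hH : MemLp H (ENNReal.ofReal p) (volume.restrict Ω)) (h : HasWeakGradient Ω w H) :
    MemW1p Ω p w :=
  ⟨hw, ⟨H, h⟩, hH.ae_eq (h.weakGrad_ae_eq hΩ).symm⟩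

lemma tendstoW1p_of_weakGrad_ae_eq {N : ℕ} {p : ℝ} {Ω : Set (EuclideanSpace ℝ (Fin N))}
    {w : EuclideanSpace ℝ (Fin N) → ℝ} {H : EuclideanSpace ℝ (Fin N) → EuclideanSpace ℝ (Fin N)}
    {f : ℕ → EuclideanSpace ℝ (Fin N) → ℝ}
    (h : weakGrad Ω w =ᵐ[volume.restrict Ω] H)
    (hfw : Tendsto (fun n => eLpNorm (fun x => f n x - w x) (ENNReal.ofReal p)
      (volume.restrict Ω)) atTop (𝓝 0))
    (hfH : Tendsto (fun n => eLpNorm (fun x => gradient (f n) x - H x) (ENNReal.ofReal p)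
      (volume.restrict Ω)) atTop (𝓝 0)) : TendstoW1p Ω p f w := by
  refine ⟨hfw, hfH.congr fun n => eLpNorm_congr_ae ?_⟩
  filter_upwards [h] with x hx
  rw [hx]

/-! ### From vanishing boundary values to `W_0^{1,p}`: mollification and cutoff. -/

/-- Mollification at radius `ρ`: uniform continuity of `g` and of its derivative gives the two
bounds, since convolution commutes with the derivative, and `ρ₃` keeps the support inside `Ω`. -/
lemma exists_testFunction_C1_near {N : ℕ} {Ω : Set (EuclideanSpace ℝ (Fin N))} (hΩ : IsOpen Ω)
    {g : EuclideanSpace ℝ (Fin N) → ℝ} (hg : ContDiff ℝ 1 g) (hgc : HasCompactSupport g)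
    (hgΩ : tsupport g ⊆ Ω) {ε : ℝ} (hε : 0 < ε) :
    ∃ ψ, IsTestFunction Ω ψ ∧ (∀ x, ‖ψ x - g x‖ ≤ ε) ∧
      ∀ x, ‖gradient ψ x - gradient g x‖ ≤ ε := by
  have hg' : Continuous (fderiv ℝ g) := hg.continuous_fderiv one_ne_zero
  obtain ⟨ρ₁, hρ₁, hu₁⟩ := Metric.uniformContinuous_iff.1
    (hgc.uniformContinuous_of_continuous hg.continuous) ε hε
  obtain ⟨ρ₂, hρ₂, hu₂⟩ := Metric.uniformContinuous_iff.1
    ((hgc.fderiv ℝ).uniformContinuous_of_continuous hg') ε hε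
  obtain ⟨ρ₃, hρ₃, hu₃⟩ := IsCompact.exists_cthickening_subset_open hgc hΩ hgΩ
  set ρ := min ρ₁ (min ρ₂ ρ₃) with hρdef
  have hρ : 0 < ρ := lt_min hρ₁ (lt_min hρ₂ hρ₃)
  let φ : ContDiffBump (0 : EuclideanSpace ℝ (Fin N)) := ⟨ρ / 2, ρ, half_pos hρ, half_lt_self hρ⟩
  set ψ := convolution (φ.normed volume) g (ContinuousLinearMap.lsmul ℝ ℝ) volume with hψdef
  have hφi : LocallyIntegrable (φ.normed volume) volume :=
    φ.continuous_normed.locallyIntegrable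
  have hfd : ∀ x, HasFDerivAt ψ (convolution (φ.normed volume) (fderiv ℝ g)
      (ContinuousLinearMap.lsmul ℝ ℝ) volume x) x := fun x =>
    hgc.hasFDerivAt_convolution_right (ContinuousLinearMap.lsmul ℝ ℝ) hφi hg x
  have hsupp : Function.support ψ ⊆ Metric.cthickening ρ (tsupport g) := by
    intro x hx
    by_contra h
    have h0 : ∀ y ∈ Metric.ball x φ.rOut, g y = 0 := fun y hy => by
      refine image_eq_zero_of_notMem_tsupport fun hy' => h ?_
      exact Metric.mem_cthickening_of_dist_le x y ρ _ hy' (by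
        rw [dist_comm]; exact (Metric.mem_ball.1 hy).le)
    refine hx ?_
    have hgx := h0 x (Metric.mem_ball_self φ.rOut_pos)
    rw [hψdef, ContDiffBump.normed_convolution_eq_right, hgx]
    intro y hy
    rw [h0 y hy, hgx]
  have htsupp : tsupport ψ ⊆ Metric.cthickening ρ (tsupport g) :=
    closure_minimal hsupp Metric.isClosed_cthickening
  refine ⟨ψ, ⟨?_, ?_, ?_⟩, fun x => ?_, fun x => ?_⟩
  · exact φ.hasCompactSupport_normed.contDiff_convolution_left _ φ.contDiff_normed
      hg.continuous.locallyIntegrable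
  · exact (IsCompact.cthickening hgc).of_isClosed_subset (isClosed_tsupport _) htsupp
  · exact htsupp.trans ((Metric.cthickening_mono
      ((min_le_right _ _).trans (min_le_right _ _)) _).trans hu₃)
  · rw [← dist_eq_norm]
    refine φ.dist_normed_convolution_le hg.continuous.aestronglyMeasurable fun y hy => ?_
    exact (hu₁ ((Metric.mem_ball.1 hy).trans_le (min_le_left _ _))).le
  · have : ‖gradient ψ x - gradient g x‖ = ‖fderiv ℝ ψ x - fderiv ℝ g x‖ := by
      simp only [gradient, ← map_sub, LinearIsometryEquiv.norm_map]
    rw [this, (hfd x).fderiv, ← dist_eq_norm]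
    refine φ.dist_normed_convolution_le hg'.aestronglyMeasurable fun y hy => ?_
    exact (hu₂ ((Metric.mem_ball.1 hy).trans_le
      ((min_le_right _ _).trans (min_le_left _ _)))).le

/-- An average of translates keeps the Lipschitz constant; hence smoothing a cutoff does not spoil
its gradient bound. -/
lemma lipschitzWith_normed_convolution {N : ℕ} (φ : ContDiffBump (0 : EuclideanSpace ℝ (Fin N)))
    {g : EuclideanSpace ℝ (Fin N) → ℝ} {K : NNReal} (hg : LipschitzWith K g) :
    LipschitzWith K (convolution (φ.normed volume) g (ContinuousLinearMap.lsmul ℝ ℝ) volume) := by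
  refine LipschitzWith.of_dist_le_mul fun x y => ?_
  have hint : ∀ x, Integrable fun t => φ.normed volume t * g (x - t) := fun x =>
    (φ.continuous_normed.mul (hg.continuous.comp (continuous_const.sub continuous_id))
      ).integrable_of_hasCompactSupport φ.hasCompactSupport_normed.mul_right
  simp only [convolution_def, ContinuousLinearMap.lsmul_apply, smul_eq_mul]
  rw [dist_eq_norm, ← integral_sub (hint x) (hint y)]
  have hb : Integrable fun t => φ.normed volume t * (K * dist x y) :=
    φ.integrable_normed.mul_const _
  refine (norm_integral_le_of_norm_le hb (Eventually.of_forall fun t => ?_)).trans_eq ?_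
  · rw [← mul_sub, norm_mul, Real.norm_of_nonneg (φ.nonneg_normed t)]
    refine mul_le_mul_of_nonneg_left ?_ (φ.nonneg_normed t)
    rw [← dist_eq_norm]
    simpa using hg.dist_le_mul (x - t) (y - t)
  · rw [integral_mul_const, φ.integral_normed, one_mul]

/-- A smooth cutoff vanishing near the complement of `Ω`, with gradient controlled by `1/δ`. -/
lemma exists_boundary_cutoff {N : ℕ} (Ω : Set (EuclideanSpace ℝ (Fin N))) {δ : ℝ} (hδ : 0 < δ) :
    ∃ χ : EuclideanSpace ℝ (Fin N) → ℝ, ContDiff ℝ 1 χ ∧ (∀ x, 0 ≤ χ x) ∧ (∀ x, χ x ≤ 1) ∧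
      (∀ x, Metric.infDist x Ωᶜ ≤ δ → χ x = 0) ∧
      (∀ x, 4 * δ ≤ Metric.infDist x Ωᶜ → χ x = 1) ∧
      (∀ x, ‖gradient χ x‖ ≤ 1 / δ) := by
  set d : EuclideanSpace ℝ (Fin N) → ℝ := fun x => Metric.infDist x Ωᶜ with hd
  have hdl : LipschitzWith 1 d := Metric.lipschitz_infDist_pt _
  -- `η` is `0` for `d ≤ 2δ` and `1` for `d ≥ 3δ`; mollifying at radius `δ` moves these thresholds
  -- to `δ` and `4δ`.
  set η : EuclideanSpace ℝ (Fin N) → ℝ := fun x => min 1 (max 0 (d x / δ - 2)) with hη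
  have hηl : LipschitzWith ⟨1 / δ, by positivity⟩ η := by
    have h1 : LipschitzWith ⟨1 / δ, by positivity⟩ fun x => d x / δ - 2 := by
      refine LipschitzWith.of_dist_le_mul fun x y => ?_
      have h2 := hdl.dist_le_mul x y
      rw [Real.dist_eq] at h2 ⊢
      have : d x / δ - 2 - (d y / δ - 2) = 1 / δ * (d x - d y) := by ring
      rw [this, abs_mul, abs_of_pos (by positivity : 0 < 1 / δ)]
      simp only [NNReal.coe_one, one_mul] at h2
      change 1 / δ * _ ≤ 1 / δ * _
      gcongr
    exact (h1.const_max 0).const_min 1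
  let φ : ContDiffBump (0 : EuclideanSpace ℝ (Fin N)) := ⟨δ / 2, δ, half_pos hδ, half_lt_self hδ⟩
  have hdist : ∀ x, ∀ y ∈ Metric.ball x δ, |d y - d x| < δ := fun x y hy => by
    have h2 := hdl.dist_le_mul y x
    rw [Real.dist_eq, NNReal.coe_one, one_mul] at h2
    exact h2.trans_lt hy
  have hone : ∀ x, 4 * δ ≤ d x → convolution (φ.normed volume) η (ContinuousLinearMap.lsmul ℝ ℝ)
      volume x = 1 := by
    intro x hx
    have h1 : ∀ y ∈ Metric.ball x δ, η y = 1 := fun y hy => by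
      have h2 := abs_lt.1 (hdist x y hy)
      have : 3 ≤ d y / δ := by rw [le_div_iff₀ hδ]; linarith
      exact min_eq_left (le_max_of_le_right (by linarith))
    have hx1 := h1 x (Metric.mem_ball_self hδ)
    rw [ContDiffBump.normed_convolution_eq_right, hx1]
    intro y hy
    rw [h1 y hy, hx1]
  have hzero : ∀ x, d x ≤ δ → convolution (φ.normed volume) η (ContinuousLinearMap.lsmul ℝ ℝ)
      volume x = 0 := by
    intro x hx
    have h1 : ∀ y ∈ Metric.ball x δ, η y = 0 := fun y hy => by
      have h2 := abs_lt.1 (hdist x y hy)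
      have : d y / δ ≤ 2 := by rw [div_le_iff₀ hδ]; linarith
      simp only [hη]
      rw [max_eq_left (by linarith)]
      simp
    have hx1 := h1 x (Metric.mem_ball_self hδ)
    rw [ContDiffBump.normed_convolution_eq_right, hx1]
    intro y hy
    rw [h1 y hy, hx1]
  have hη0 : ∀ x, 0 ≤ η x := fun x => le_min zero_le_one (le_max_left _ _)
  have hη1 : ∀ x, η x ≤ 1 := fun x => min_le_left _ _
  refine ⟨_, ?_, fun x => ?_, fun x => ?_, hzero, hone, fun x => ?_⟩
  · exact (φ.hasCompactSupport_normed.contDiff_convolution_left (n := 1) _ φ.contDiff_normed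
      hηl.continuous.locallyIntegrable)
  · simp only [convolution_def, ContinuousLinearMap.lsmul_apply, smul_eq_mul]
    exact integral_nonneg fun t => mul_nonneg (φ.nonneg_normed t) (hη0 _)
  · simp only [convolution_def, ContinuousLinearMap.lsmul_apply, smul_eq_mul]
    rw [← φ.integral_normed (μ := volume)]
    refine integral_mono_of_nonneg (Eventually.of_forall fun t =>
      mul_nonneg (φ.nonneg_normed t) (hη0 _)) φ.integrable_normed (Eventually.of_forall fun t => ?_)
    exact mul_le_of_le_one_right (φ.nonneg_normed t) (hη1 _)
  · rw [norm_gradient]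
    exact norm_fderiv_le_of_lipschitz ℝ (lipschitzWith_normed_convolution φ hηl)

/-- Passing to the limit in the strip estimate at fixed `δ` removes the boundary term: its
coefficient is finite and the boundary norms tend to zero. -/
lemma eLpNorm_boundaryStrip_le_of_tendsto {N : ℕ} {p : ℝ} (hp : 1 < p)
    {Ω : Set (EuclideanSpace ℝ (Fin N))} (hΩ : IsOpen Ω) (hΩb : Bornology.IsBounded Ω)
    (hne : Ωᶜ.Nonempty) (hΩL : HasLipschitzBoundary Ω) :
    ∃ (M : ℝ≥0∞) (C δ₀ : ℝ), M ≠ ⊤ ∧ 1 ≤ C ∧ 0 < δ₀ ∧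
      ∀ (w : EuclideanSpace ℝ (Fin N) → ℝ) (H : EuclideanSpace ℝ (Fin N) → EuclideanSpace ℝ (Fin N))
      (f : ℕ → EuclideanSpace ℝ (Fin N) → ℝ),
      MemLp w (ENNReal.ofReal p) (volume.restrict Ω) →
      MemLp H (ENNReal.ofReal p) (volume.restrict Ω) →
      (∀ n, ContDiff ℝ 1 (f n)) →
      Tendsto (fun n => eLpNorm (fun x => f n x - w x) (ENNReal.ofReal p)
        (volume.restrict Ω)) atTop (𝓝 0) →
      Tendsto (fun n => eLpNorm (fun x => gradient (f n) x - H x) (ENNReal.ofReal p)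
        (volume.restrict Ω)) atTop (𝓝 0) →
      Tendsto (fun n => eLpNorm (f n) (ENNReal.ofReal p) (surfaceMeasure Ω)) atTop (𝓝 0) →
      ∀ δ, 0 < δ → δ ≤ δ₀ →
        eLpNorm w (ENNReal.ofReal p) (volume.restrict (boundaryStrip Ω δ)) ≤
          M * (ENNReal.ofReal (C * δ) * eLpNorm H (ENNReal.ofReal p)
              (volume.restrict (boundaryStrip Ω (C * δ)))) := by
  obtain ⟨M, C, δ₀, hM, hC, hδ₀, hstrip⟩ := eLpNorm_boundaryStrip_le hp hΩ hΩb hne hΩL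
  refine ⟨M, C, δ₀, hM, hC, hδ₀, fun w H f hw hH hf hfw hfH hfs δ hδ hδ' => ?_⟩
  set P := ENNReal.ofReal p
  have hP : 1 ≤ P := by simpa [P] using hp.le
  have hle : ∀ δ, volume.restrict (boundaryStrip Ω δ) ≤ volume.restrict Ω := fun δ =>
    Measure.restrict_mono_set _ Set.inter_subset_left
  set c₁ := ENNReal.ofReal (C * δ) ^ (1 / p)
  have hc₁ : c₁ ≠ ⊤ := ENNReal.rpow_ne_top_of_nonneg (by positivity) (by simp)
  have hbound : ∀ n, eLpNorm w P (volume.restrict (boundaryStrip Ω δ)) ≤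
      eLpNorm (fun x => f n x - w x) P (volume.restrict Ω) +
        M * (c₁ * eLpNorm (f n) P (surfaceMeasure Ω) + ENNReal.ofReal (C * δ) *
          (eLpNorm H P (volume.restrict (boundaryStrip Ω (C * δ))) +
            eLpNorm (fun x => gradient (f n) x - H x) P (volume.restrict Ω))) := by
    intro n
    have hfm := (hf n).continuous.aestronglyMeasurable (μ := volume.restrict (boundaryStrip Ω δ))
    have hgm := (continuous_gradient (hf n)).aestronglyMeasurable
      (μ := volume.restrict (boundaryStrip Ω (C * δ)))
    have hwm := hw.aestronglyMeasurable.mono_measure (hle δ)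
    have hHm := hH.aestronglyMeasurable.mono_measure (hle (C * δ))
    have h1 : eLpNorm w P (volume.restrict (boundaryStrip Ω δ)) ≤
        eLpNorm (fun x => f n x - w x) P (volume.restrict (boundaryStrip Ω δ)) +
        eLpNorm (f n) P (volume.restrict (boundaryStrip Ω δ)) := by
      have : w = fun x => -(f n x - w x) + f n x := by funext x; ring
      conv_lhs => rw [this]
      refine (eLpNorm_add_le (hfm.sub hwm).neg hfm hP).trans_eq ?_
      congr 1
      exact eLpNorm_neg (fun x => f n x - w x) _ _
    have h2 : eLpNorm (gradient (f n)) P (volume.restrict (boundaryStrip Ω (C * δ))) ≤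
        eLpNorm H P (volume.restrict (boundaryStrip Ω (C * δ))) +
        eLpNorm (fun x => gradient (f n) x - H x) P
          (volume.restrict (boundaryStrip Ω (C * δ))) := by
      have : gradient (f n) = H + fun x => gradient (f n) x - H x := by
        funext x; simp
      conv_lhs => rw [this]
      exact eLpNorm_add_le hHm (hgm.sub hHm) hP
    refine h1.trans (add_le_add (eLpNorm_mono_measure _ (hle δ)) ?_)
    refine (hstrip δ hδ hδ' (f n) (hf n)).trans ?_
    gcongr
    exact h2.trans (add_le_add le_rfl (eLpNorm_mono_measure _ (hle _)))
  refine ge_of_tendsto' (x := atTop) ?_ hbound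
  have t1 := ENNReal.Tendsto.const_mul (a := c₁) hfs (Or.inr hc₁)
  have t2 := ENNReal.Tendsto.const_mul (a := ENNReal.ofReal (C * δ))
    (tendsto_const_nhds (x := eLpNorm H P (volume.restrict (boundaryStrip Ω (C * δ)))) |>.add hfH)
    (Or.inr ENNReal.ofReal_ne_top)
  have t3 := hfw.add (ENNReal.Tendsto.const_mul (a := M) (t1.add t2) (Or.inr hM))
  simpa using t3

lemma gradient_mul {N : ℕ} {f g : EuclideanSpace ℝ (Fin N) → ℝ} {x : EuclideanSpace ℝ (Fin N)}
    (hf : DifferentiableAt ℝ f x) (hg : DifferentiableAt ℝ g x) :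
    gradient (fun y => f y * g y) x = f x • gradient g x + g x • gradient f x := by
  simp only [gradient]
  rw [fderiv_fun_mul hf hg, map_add]
  simp

/-- The approximant is `f n * χ`. First `δ` is fixed so that the errors living on the strip are
small; then `n` is taken large, depending on `δ`, to absorb the factor `1/δ` in front of `f n - w`.
-/
lemma exists_C1_compactSupport_near {N : ℕ} {p : ℝ} (hp : 1 < p)
    {Ω : Set (EuclideanSpace ℝ (Fin N))} (hΩ : IsOpen Ω) (hΩb : Bornology.IsBounded Ω)
    (hne : Ωᶜ.Nonempty) (hΩL : HasLipschitzBoundary Ω)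
    {w : EuclideanSpace ℝ (Fin N) → ℝ} {H : EuclideanSpace ℝ (Fin N) → EuclideanSpace ℝ (Fin N)}
    {f : ℕ → EuclideanSpace ℝ (Fin N) → ℝ}
    (hw : MemLp w (ENNReal.ofReal p) (volume.restrict Ω))
    (hH : MemLp H (ENNReal.ofReal p) (volume.restrict Ω))
    (hf : ∀ n, ContDiff ℝ 1 (f n))
    (hfw : Tendsto (fun n => eLpNorm (fun x => f n x - w x) (ENNReal.ofReal p)
      (volume.restrict Ω)) atTop (𝓝 0))
    (hfH : Tendsto (fun n => eLpNorm (fun x => gradient (f n) x - H x) (ENNReal.ofReal p)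
      (volume.restrict Ω)) atTop (𝓝 0))
    (hfs : Tendsto (fun n => eLpNorm (f n) (ENNReal.ofReal p) (surfaceMeasure Ω)) atTop (𝓝 0))
    {ε : ℝ≥0∞} (hε : ε ≠ 0) :
    ∃ g : EuclideanSpace ℝ (Fin N) → ℝ, ContDiff ℝ 1 g ∧ HasCompactSupport g ∧ tsupport g ⊆ Ω ∧
      eLpNorm (fun x => g x - w x) (ENNReal.ofReal p) (volume.restrict Ω) ≤ ε ∧
      eLpNorm (fun x => gradient g x - H x) (ENNReal.ofReal p) (volume.restrict Ω) ≤ ε := by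
  obtain ⟨M, C, δ₀, hM, hC, hδ₀, hstrip⟩ :=
    eLpNorm_boundaryStrip_le_of_tendsto hp hΩ hΩb hne hΩL
  replace hstrip := hstrip w H f hw hH hf hfw hfH hfs
  set P := ENNReal.ofReal p
  have hP : 1 ≤ P := by simpa [P] using hp.le
  set T : ℝ → ℝ≥0∞ := fun δ => eLpNorm H P (volume.restrict (boundaryStrip Ω (C * (4 * δ))))
    with hT
  -- Collects the two errors on the strip: `1` for `(χ - 1) • H`, and `M * ENNReal.ofReal (C * 4)`
  -- for `w • ∇χ`.
  set c := 1 + M * ENNReal.ofReal (C * 4) with hc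
  have hctop : c ≠ ⊤ := by simp [hc, ENNReal.mul_ne_top, hM]
  obtain ⟨δ, hδ, hδ1, hδδ₀, hδT⟩ : ∃ δ, 0 < δ ∧ δ ≤ 1 ∧ 4 * δ ≤ δ₀ ∧ c * T δ < ε := by
    set κ := min 1 (δ₀ / 4)
    have hκ : 0 < κ := lt_min one_pos (by positivity)
    have hanti : Antitone fun n : ℕ => κ / ((n : ℝ) + 1) := fun m n hmn => by
      dsimp only
      gcongr
    have h0 : Tendsto (fun n : ℕ => C * (4 * (κ / ((n : ℝ) + 1)))) atTop (𝓝 0) := by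
      have h1 := ((tendsto_one_div_add_atTop_nhds_zero_nat (𝕜 := ℝ)).const_mul κ).const_mul (C * 4)
      simp only [mul_zero] at h1
      refine h1.congr fun n => ?_
      ring
    have h1 := tendsto_eLpNorm_boundaryStrip hp hΩ hΩb hne hH
      (δ := fun n : ℕ => C * (4 * (κ / ((n : ℝ) + 1))))
      (fun m n hmn => by
        have := hanti hmn
        dsimp only at this ⊢
        gcongr) h0
    have h2 := ENNReal.Tendsto.const_mul (a := c) h1 (Or.inr hctop)
    rw [mul_zero] at h2
    obtain ⟨n, hn⟩ := (h2.eventually_lt_const (pos_iff_ne_zero.2 hε)).exists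
    have h3 : κ / ((n : ℝ) + 1) ≤ κ := div_le_self hκ.le (by simp)
    refine ⟨κ / ((n : ℝ) + 1), by positivity, h3.trans (min_le_left _ _), ?_, hn⟩
    have := h3.trans (min_le_right _ _)
    linarith
  set D := ENNReal.ofReal (1 / δ) with hD
  have hwS := hstrip (4 * δ) (by positivity) hδδ₀
  obtain ⟨n, hn⟩ : ∃ n, eLpNorm (fun x => gradient (f n) x - H x) P (volume.restrict Ω) +
      (1 + D) * eLpNorm (fun x => f n x - w x) P (volume.restrict Ω) + c * T δ < ε := by
    have h1 := (hfH.add (ENNReal.Tendsto.const_mul (a := 1 + D) hfw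
      (Or.inr (by simp [hD])))).add_const (c * T δ)
    simp only [mul_zero, add_zero, zero_add] at h1
    exact (h1.eventually_lt_const hδT).exists
  obtain ⟨χ, hχ, hχ0, hχ1, hχz, hχo, hχg⟩ := exists_boundary_cutoff Ω hδ
  set S := boundaryStrip Ω (4 * δ) with hS
  have hSm : MeasurableSet S := (isOpen_boundaryStrip hΩ _).measurableSet
  have hSr : (volume.restrict Ω).restrict S = volume.restrict S :=
    Measure.restrict_restrict_of_subset Set.inter_subset_left
  have hoff : ∀ x ∈ Ω, x ∉ S → χ x = 1 ∧ gradient χ x = 0 := by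
    intro x hx hxS
    have h1 : χ x = 1 := hχo x (not_lt.1 fun h => hxS ⟨hx, h⟩)
    refine ⟨h1, ?_⟩
    -- `χ` attains its maximum `1` here, so its gradient vanishes even at distance exactly `4δ`,
    -- where `χ` need not be locally constant.
    have h2 : IsLocalMax χ x := Eventually.of_forall fun y => by rw [h1]; exact hχ1 y
    simp [gradient, h2.fderiv_eq_zero]
  have hΩae : ∀ {q : EuclideanSpace ℝ (Fin N) → Prop}, (∀ x ∈ Ω, q x) →
      ∀ᵐ x ∂volume.restrict Ω, q x := fun h =>
    (ae_restrict_iff' hΩ.measurableSet).2 (Eventually.of_forall h)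
  have hwm := hw.aestronglyMeasurable
  have hHm := hH.aestronglyMeasurable
  have hfm := (hf n).continuous.aestronglyMeasurable (μ := volume.restrict Ω)
  have hfgm := (continuous_gradient (hf n)).aestronglyMeasurable (μ := volume.restrict Ω)
  have hχm := hχ.continuous.aestronglyMeasurable (μ := volume.restrict Ω)
  have hχgm := (continuous_gradient hχ).aestronglyMeasurable (μ := volume.restrict Ω)
  have hχabs : ∀ x, ‖χ x‖ ≤ 1 := fun x => by rw [Real.norm_of_nonneg (hχ0 x)]; exact hχ1 x
  have hχabs' : ∀ x, ‖χ x - 1‖ ≤ 1 := fun x => by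
    rw [Real.norm_eq_abs, abs_le]; constructor <;> linarith [hχ0 x, hχ1 x]
  have hTS : eLpNorm H P (volume.restrict S) ≤ T δ := by
    refine eLpNorm_mono_measure _ (Measure.restrict_mono_set _ (boundaryStrip_mono Ω ?_))
    exact le_mul_of_one_le_left (by positivity) hC
  -- The decisive cancellation: `1/δ` from the cutoff against `4Cδ` from the strip estimate.
  have hDw : D * eLpNorm w P (volume.restrict S) ≤ M * ENNReal.ofReal (C * 4) * T δ := by
    refine (mul_le_mul_right hwS D).trans_eq ?_
    have : ENNReal.ofReal (C * 4) = D * ENNReal.ofReal (C * (4 * δ)) := by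
      rw [hD, ← ENNReal.ofReal_mul (by positivity)]
      congr 1
      field_simp
    rw [this]
    ring
  -- This is the purpose of `δ ≤ 1`: the bound on `D * ‖w‖` over the strip then also covers `‖w‖`
  -- itself.
  have hD1 : 1 ≤ D := by
    rw [hD, ← ENNReal.ofReal_one]
    exact ENNReal.ofReal_le_ofReal ((one_le_div hδ).2 hδ1)
  have hrestr : ∀ {E₁ E₂ : Type} [NormedAddCommGroup E₁] [NormedAddCommGroup E₂]
      (F : EuclideanSpace ℝ (Fin N) → E₁) (G : EuclideanSpace ℝ (Fin N) → E₂) (a : ℝ),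
      (∀ x ∈ S, ‖F x‖ ≤ a * ‖G x‖) → (∀ x ∈ Ω, x ∉ S → F x = 0) →
      eLpNorm F P (volume.restrict Ω) ≤ ENNReal.ofReal a * eLpNorm G P (volume.restrict S) := by
    intro E₁ E₂ _ _ F G a hFG hF
    have h1 : F =ᵐ[volume.restrict Ω] S.indicator F := hΩae fun x hx => by
      by_cases hxS : x ∈ S
      · rw [Set.indicator_of_mem hxS]
      · rw [Set.indicator_of_notMem hxS, hF x hx hxS]
    rw [eLpNorm_congr_ae h1, eLpNorm_indicator_eq_eLpNorm_restrict hSm, hSr]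
    exact eLpNorm_le_mul_eLpNorm_of_ae_le_mul
      ((ae_restrict_iff' hSm).2 (Eventually.of_forall hFG)) _
  have hχf : eLpNorm (fun x => χ x * (f n x - w x)) P (volume.restrict Ω) ≤
      eLpNorm (fun x => f n x - w x) P (volume.restrict Ω) := by
    refine eLpNorm_mono fun x => ?_
    rw [norm_mul]
    exact mul_le_of_le_one_left (norm_nonneg _) (hχabs x)
  have hsum : eLpNorm (fun x => f n x - w x) P (volume.restrict Ω) +
      D * eLpNorm w P (volume.restrict S) ≤
      eLpNorm (fun x => gradient (f n) x - H x) P (volume.restrict Ω) +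
      (1 + D) * eLpNorm (fun x => f n x - w x) P (volume.restrict Ω) + c * T δ := by
    refine add_le_add ?_ (hDw.trans ?_)
    · rw [add_mul, one_mul]
      exact le_add_left le_self_add
    · rw [hc, add_mul]
      exact le_add_self
  have hzero : ∀ x, x ∉ {x | δ ≤ Metric.infDist x Ωᶜ} → f n x * χ x = 0 := fun x hx => by
    rw [hχz x (not_le.1 hx).le, mul_zero]
  have hts : tsupport (fun x => f n x * χ x) ⊆ {x | δ ≤ Metric.infDist x Ωᶜ} :=
    closure_minimal (fun x hx => by
      by_contra h
      exact hx (hzero x h)) (isClosed_le continuous_const (Metric.continuous_infDist_pt _))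
  have hts' : tsupport (fun x => f n x * χ x) ⊆ Ω := fun x hx => by
    by_contra h
    have h1 : δ ≤ Metric.infDist x Ωᶜ := hts hx
    rw [Metric.infDist_zero_of_mem h] at h1
    linarith
  refine ⟨fun x => f n x * χ x, (hf n).mul hχ, ?_, hts', ?_, ?_⟩
  · exact hΩb.isCompact_closure.of_isClosed_subset (isClosed_tsupport _)
      (hts'.trans subset_closure)
  · have heq : (fun x => f n x * χ x - w x) =
        (fun x => χ x * (f n x - w x)) + fun x => (χ x - 1) * w x := by
      funext x; simp only [Pi.add_apply]; ring
    rw [heq]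
    refine (eLpNorm_add_le (f := fun x => χ x * (f n x - w x)) (g := fun x => (χ x - 1) * w x)
      (hχm.mul (hfm.sub hwm)) ((hχm.sub aestronglyMeasurable_const).mul hwm) hP).trans
      ((add_le_add hχf ?_).trans (hsum.trans hn.le))
    refine (hrestr (fun x => (χ x - 1) * w x) w 1 (fun x _ => ?_) fun x hx hxS => ?_).trans ?_
    · rw [norm_mul]
      gcongr
      exact hχabs' x
    · simp [(hoff x hx hxS).1]
    · rw [ENNReal.ofReal_one]
      gcongr
  · have heq : (fun x => gradient (fun y => f n y * χ y) x - H x) =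
        (fun x => χ x • (gradient (f n) x - H x)) + ((fun x => (χ x - 1) • H x) +
          ((fun x => (f n x - w x) • gradient χ x) + fun x => w x • gradient χ x)) := by
      funext x
      simp only [Pi.add_apply]
      rw [gradient_mul ((hf n).differentiable one_ne_zero x) (hχ.differentiable one_ne_zero x)]
      module
    have m₁ : AEStronglyMeasurable (fun x => χ x • (gradient (f n) x - H x)) (volume.restrict Ω) :=
      hχm.smul (hfgm.sub hHm)
    have m₂ : AEStronglyMeasurable (fun x => (χ x - 1) • H x) (volume.restrict Ω) :=
      (hχm.sub aestronglyMeasurable_const).smul hHm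
    have m₃ : AEStronglyMeasurable (fun x => (f n x - w x) • gradient χ x) (volume.restrict Ω) :=
      (hfm.sub hwm).smul hχgm
    have m₄ : AEStronglyMeasurable (fun x => w x • gradient χ x) (volume.restrict Ω) :=
      hwm.smul hχgm
    have b₁ : eLpNorm (fun x => χ x • (gradient (f n) x - H x)) P (volume.restrict Ω) ≤
        eLpNorm (fun x => gradient (f n) x - H x) P (volume.restrict Ω) := by
      refine eLpNorm_mono fun x => ?_
      rw [norm_smul]
      exact mul_le_of_le_one_left (norm_nonneg _) (hχabs x)
    have b₂ : eLpNorm (fun x => (χ x - 1) • H x) P (volume.restrict Ω) ≤ 1 * T δ := by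
      refine (hrestr _ H 1 (fun x _ => ?_) fun x hx hxS => ?_).trans ?_
      · rw [norm_smul]
        gcongr
        exact hχabs' x
      · simp [(hoff x hx hxS).1]
      · rw [ENNReal.ofReal_one]
        gcongr
    have b₃ : eLpNorm (fun x => (f n x - w x) • gradient χ x) P (volume.restrict Ω) ≤
        D * eLpNorm (fun x => f n x - w x) P (volume.restrict Ω) := by
      refine eLpNorm_le_mul_eLpNorm_of_ae_le_mul (Eventually.of_forall fun x => ?_) _
      rw [norm_smul, mul_comm]
      gcongr
      exact hχg x
    have b₄ : eLpNorm (fun x => w x • gradient χ x) P (volume.restrict Ω) ≤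
        M * ENNReal.ofReal (C * 4) * T δ := by
      refine (hrestr _ w (1 / δ) (fun x _ => ?_) fun x hx hxS => ?_).trans hDw
      · rw [norm_smul, mul_comm]
        gcongr
        exact hχg x
      · simp [(hoff x hx hxS).2]
    rw [heq]
    refine (eLpNorm_add_le m₁ (m₂.add (m₃.add m₄)) hP).trans ?_
    refine (add_le_add b₁ ((eLpNorm_add_le m₂ (m₃.add m₄) hP).trans
      (add_le_add b₂ ((eLpNorm_add_le m₃ m₄ hP).trans (add_le_add b₃ b₄))))).trans (le_trans ?_ hn.le)
    rw [hc, add_mul, add_mul]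
    calc _ = eLpNorm (fun x => gradient (f n) x - H x) P (volume.restrict Ω) +
          D * eLpNorm (fun x => f n x - w x) P (volume.restrict Ω) +
          (1 * T δ + M * ENNReal.ofReal (C * 4) * T δ) := by ring
      _ ≤ _ := by
        gcongr
        exact le_add_self

/-- Limits of `C¹` functions whose boundary values tend to zero are in `W_0^{1,p}`. -/
theorem memW01p_of_tendsto {N : ℕ} {p : ℝ} (hp : 1 < p)
    {Ω : Set (EuclideanSpace ℝ (Fin N))} (hΩ : IsOpen Ω) (hΩb : Bornology.IsBounded Ω)
    (hne : Ωᶜ.Nonempty) (hΩL : HasLipschitzBoundary Ω)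
    {w : EuclideanSpace ℝ (Fin N) → ℝ} {H : EuclideanSpace ℝ (Fin N) → EuclideanSpace ℝ (Fin N)}
    {f : ℕ → EuclideanSpace ℝ (Fin N) → ℝ}
    (hw : MemLp w (ENNReal.ofReal p) (volume.restrict Ω))
    (hH : MemLp H (ENNReal.ofReal p) (volume.restrict Ω))
    (hf : ∀ n, ContDiff ℝ 1 (f n))
    (hfw : Tendsto (fun n => eLpNorm (fun x => f n x - w x) (ENNReal.ofReal p)
      (volume.restrict Ω)) atTop (𝓝 0))
    (hfH : Tendsto (fun n => eLpNorm (fun x => gradient (f n) x - H x) (ENNReal.ofReal p)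
      (volume.restrict Ω)) atTop (𝓝 0))
    (hfs : Tendsto (fun n => eLpNorm (f n) (ENNReal.ofReal p) (surfaceMeasure Ω)) atTop (𝓝 0)) :
    MemW01p Ω p w ∧ weakGrad Ω w =ᵐ[volume.restrict Ω] H := by
  have hwg := hasWeakGradient_of_tendsto hp hΩ hΩb hw hH hf hfw hfH
  have hwH := hwg.weakGrad_ae_eq hΩ
  refine ⟨⟨memW1p_of_hasWeakGradient hΩ hw hH hwg, ?_⟩, hwH⟩
  have hfin := isFiniteMeasure_restrict_of_isBounded hΩb
  set P := ENNReal.ofReal p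
  have hP : 1 ≤ P := by simpa [P] using hp.le
  have hex : ∀ n : ℕ, ∃ ψ, IsTestFunction Ω ψ ∧
      eLpNorm (fun x => ψ x - w x) P (volume.restrict Ω) ≤ 2 * ((n : ℝ≥0∞) + 1)⁻¹ ∧
      eLpNorm (fun x => gradient ψ x - H x) P (volume.restrict Ω) ≤ 2 * ((n : ℝ≥0∞) + 1)⁻¹ := by
    intro n
    have hε : ((n : ℝ≥0∞) + 1)⁻¹ ≠ 0 :=
      ENNReal.inv_ne_zero.2 (ENNReal.add_ne_top.2 ⟨ENNReal.natCast_ne_top n, ENNReal.one_ne_top⟩)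
    obtain ⟨g, hg, hgc, hgΩ, hg1, hg2⟩ :=
      exists_C1_compactSupport_near hp hΩ hΩb hne hΩL hw hH hf hfw hfH hfs hε
    -- A uniform error `η` costs at most `η` times the `1/p`-th power of the volume of `Ω` in `L^p`;
    -- `η` is chosen accordingly.
    have hV : (volume.restrict Ω) Set.univ ^ P.toReal⁻¹ ≠ ⊤ :=
      ENNReal.rpow_ne_top_of_nonneg (by positivity) (measure_ne_top _ _)
    obtain ⟨η, hη, hηV⟩ := ENNReal.exists_nnreal_pos_mul_lt hV hε
    obtain ⟨ψ, hψ, hψ1, hψ2⟩ := exists_testFunction_C1_near hΩ hg hgc hgΩ (ε := η) (by exact_mod_cast hη)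
    have hbd : (volume.restrict Ω) Set.univ ^ P.toReal⁻¹ * ENNReal.ofReal η ≤ ((n : ℝ≥0∞) + 1)⁻¹ := by
      rw [ENNReal.ofReal_coe_nnreal, mul_comm]
      exact hηV.le
    refine ⟨ψ, hψ, ?_, ?_⟩
    · have heq : (fun x => ψ x - w x) = (fun x => ψ x - g x) + fun x => g x - w x := by
        funext x; simp
      rw [heq, two_mul]
      refine (eLpNorm_add_le (f := fun x => ψ x - g x) (g := fun x => g x - w x)
        (hψ.continuous.sub hg.continuous).aestronglyMeasurable
        (hg.continuous.aestronglyMeasurable.sub hw.aestronglyMeasurable) hP).trans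
        (add_le_add ((eLpNorm_le_of_ae_bound (Eventually.of_forall hψ1)).trans hbd) hg1)
    · have heq : (fun x => gradient ψ x - H x) =
          (fun x => gradient ψ x - gradient g x) + fun x => gradient g x - H x := by
        funext x; simp
      rw [heq, two_mul]
      refine (eLpNorm_add_le (f := fun x => gradient ψ x - gradient g x)
        (g := fun x => gradient g x - H x)
        ((continuous_gradient hψ.contDiff_one).sub (continuous_gradient hg)).aestronglyMeasurable
        ((continuous_gradient hg).aestronglyMeasurable.sub hH.aestronglyMeasurable) hP).trans
        (add_le_add ((eLpNorm_le_of_ae_bound (Eventually.of_forall hψ2)).trans hbd) hg2)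
  choose ψ hψ hψ1 hψ2 using hex
  have ht : Tendsto (fun n : ℕ => 2 * ((n : ℝ≥0∞) + 1)⁻¹) atTop (𝓝 0) := by
    have h1 := (tendsto_add_atTop_iff_nat 1).2 ENNReal.tendsto_inv_nat_nhds_zero
    have h2 := ENNReal.Tendsto.const_mul (a := 2) h1 (Or.inr (by simp))
    simpa using h2
  exact ⟨ψ, hψ, tendstoW1p_of_weakGrad_ae_eq hwH
    (tendsto_of_tendsto_of_tendsto_of_le_of_le tendsto_const_nhds ht (fun _ => zero_le) hψ1)
    (tendsto_of_tendsto_of_tendsto_of_le_of_le tendsto_const_nhds ht (fun _ => zero_le) hψ2)⟩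

/-! ### A C¹ positive part and the test function built from it. -/

/-- A continuous function, positive exactly on `(0, ∞)`, with values in `[0, 1]`. -/
def rampDeriv (s : ℝ) : ℝ := max 0 (min s 1)

/-- A `C¹` function, positive exactly on `(0, ∞)`, with derivative `rampDeriv`. -/
def ramp (s : ℝ) : ℝ := ∫ t in (0)..s, rampDeriv t

lemma continuous_rampDeriv : Continuous rampDeriv :=
  continuous_const.max (continuous_id.min continuous_const)

lemma rampDeriv_nonneg (s : ℝ) : 0 ≤ rampDeriv s := le_max_left _ _

lemma rampDeriv_le_one (s : ℝ) : rampDeriv s ≤ 1 := max_le zero_le_one (min_le_right _ _)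

lemma norm_rampDeriv_le_one (s : ℝ) : ‖rampDeriv s‖ ≤ 1 := by
  rw [Real.norm_of_nonneg (rampDeriv_nonneg s)]
  exact rampDeriv_le_one s

lemma rampDeriv_of_nonpos {s : ℝ} (hs : s ≤ 0) : rampDeriv s = 0 :=
  max_eq_left ((min_le_left _ _).trans hs)

lemma rampDeriv_pos {s : ℝ} (hs : 0 < s) : 0 < rampDeriv s :=
  lt_max_of_lt_right (lt_min hs one_pos)

lemma hasDerivAt_ramp (s : ℝ) : HasDerivAt ramp (rampDeriv s) s :=
  (continuous_rampDeriv.integral_hasStrictDerivAt 0 s).hasDerivAt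

lemma contDiff_ramp : ContDiff ℝ 1 ramp := by
  refine contDiff_one_iff_deriv.2 ⟨fun s => (hasDerivAt_ramp s).differentiableAt, ?_⟩
  rw [funext fun s => (hasDerivAt_ramp s).deriv]
  exact continuous_rampDeriv

lemma ramp_zero : ramp 0 = 0 := by simp [ramp]

lemma monotone_ramp : Monotone ramp :=
  monotone_of_deriv_nonneg (fun s => (hasDerivAt_ramp s).differentiableAt) fun s => by
    rw [(hasDerivAt_ramp s).deriv]
    exact rampDeriv_nonneg s

lemma ramp_of_nonpos {s : ℝ} (hs : s ≤ 0) : ramp s = 0 := by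
  rw [ramp, intervalIntegral.integral_symm, intervalIntegral.integral_of_le hs,
    setIntegral_eq_zero_of_forall_eq_zero, neg_zero]
  exact fun t ht => rampDeriv_of_nonpos ht.2

lemma ramp_nonneg (s : ℝ) : 0 ≤ ramp s := by
  rcases le_total s 0 with h | h
  · rw [ramp_of_nonpos h]
  · rw [← ramp_zero]
    exact monotone_ramp h

lemma ramp_pos {s : ℝ} (hs : 0 < s) : 0 < ramp s :=
  intervalIntegral.intervalIntegral_pos_of_pos_on
    (continuous_rampDeriv.intervalIntegrable _ _) (fun _ ht => rampDeriv_pos ht.1) hs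

lemma norm_ramp_sub_le (s t : ℝ) : ‖ramp s - ramp t‖ ≤ ‖s - t‖ := by
  have h : LipschitzWith 1 ramp :=
    lipschitzWith_of_nnnorm_deriv_le (fun s => (hasDerivAt_ramp s).differentiableAt) fun s => by
      rw [(hasDerivAt_ramp s).deriv]
      exact norm_rampDeriv_le_one s
  simpa [dist_eq_norm] using h.dist_le_mul s t

lemma gradient_ramp_comp {N : ℕ} {f : EuclideanSpace ℝ (Fin N) → ℝ}
    {x : EuclideanSpace ℝ (Fin N)} (hf : DifferentiableAt ℝ f x) :
    gradient (fun y => ramp (f y)) x = rampDeriv (f x) • gradient f x := by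
  have h := (hasDerivAt_ramp (f x)).comp_hasFDerivAt x hf.hasFDerivAt
  have h2 : fderiv ℝ (fun y => ramp (f y)) x = rampDeriv (f x) • fderiv ℝ f x := h.fderiv
  simp [gradient, h2]

lemma gradient_sub {N : ℕ} {f g : EuclideanSpace ℝ (Fin N) → ℝ} {x : EuclideanSpace ℝ (Fin N)}
    (hf : DifferentiableAt ℝ f x) (hg : DifferentiableAt ℝ g x) :
    gradient (fun y => f y - g y) x = gradient f x - gradient g x := by
  simp only [gradient]
  rw [fderiv_fun_sub hf hg, map_sub]

lemma tendsto_eLpNorm_of_dominated {α E : Type*} [MeasurableSpace α] {μ : Measure α}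
    [NormedAddCommGroup E] {p : ℝ} (hp : 1 < p) {F : ℕ → α → E} {V : α → E}
    (hF : ∀ n, AEStronglyMeasurable (F n) μ) (hV : MemLp V (ENNReal.ofReal p) μ)
    (hFV : ∀ n, ∀ᵐ x ∂μ, ‖F n x‖ ≤ ‖V x‖) (hlim : ∀ᵐ x ∂μ, Tendsto (fun n => F n x) atTop (𝓝 0)) :
    Tendsto (fun n => eLpNorm (F n) (ENNReal.ofReal p) μ) atTop (𝓝 0) := by
  have hp0 : 0 < p := by linarith
  have hpp : ENNReal.ofReal p ≠ 0 := by simpa using hp0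
  have h1 := hV.2
  rw [eLpNorm_lt_top_iff_lintegral_rpow_enorm_lt_top hpp ENNReal.ofReal_ne_top,
    ENNReal.toReal_ofReal hp0.le] at h1
  have h2 : Tendsto (fun n => ∫⁻ x, ‖F n x‖ₑ ^ p ∂μ) atTop (𝓝 (∫⁻ _, 0 ∂μ)) := by
    refine tendsto_lintegral_of_dominated_convergence' (fun x => ‖V x‖ₑ ^ p)
      (fun n => (hF n).enorm.pow_const _) (fun n => ?_) h1.ne ?_
    · filter_upwards [hFV n] with x hx
      exact ENNReal.rpow_le_rpow (enorm_le_iff_norm_le.2 hx) hp0.le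
    · filter_upwards [hlim] with x hx
      have h3 := (continuous_enorm.tendsto _).comp hx
      have h4 := h3.ennrpow_const p
      simpa [ENNReal.zero_rpow_of_pos hp0] using h4
  rw [lintegral_zero] at h2
  have h3 := h2.ennrpow_const (1 / p)
  rw [ENNReal.zero_rpow_of_pos (by positivity)] at h3
  refine h3.congr fun n => ?_
  rw [eLpNorm_eq_lintegral_rpow_enorm_toReal hpp ENNReal.ofReal_ne_top,
    ENNReal.toReal_ofReal hp0.le]

lemma tendsto_eLpNorm_sub_sub {α E : Type*} [MeasurableSpace α] {μ : Measure α}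
    [NormedAddCommGroup E] {P : ℝ≥0∞} (hP : 1 ≤ P) {F₁ F₂ : ℕ → α → E} {f₁ f₂ : α → E}
    (hF₁ : ∀ n, AEStronglyMeasurable (F₁ n) μ) (hF₂ : ∀ n, AEStronglyMeasurable (F₂ n) μ)
    (hf₁ : AEStronglyMeasurable f₁ μ) (hf₂ : AEStronglyMeasurable f₂ μ)
    (h₁ : Tendsto (fun n => eLpNorm (fun x => F₁ n x - f₁ x) P μ) atTop (𝓝 0))
    (h₂ : Tendsto (fun n => eLpNorm (fun x => F₂ n x - f₂ x) P μ) atTop (𝓝 0)) :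
    Tendsto (fun n => eLpNorm (fun x => (F₁ n x - F₂ n x) - (f₁ x - f₂ x)) P μ) atTop (𝓝 0) := by
  have h3 := h₁.add h₂
  rw [add_zero] at h3
  refine tendsto_of_tendsto_of_tendsto_of_le_of_le tendsto_const_nhds h3 (fun _ => zero_le)
    fun n => ?_
  have : (fun x => (F₁ n x - F₂ n x) - (f₁ x - f₂ x)) =
      (fun x => F₁ n x - f₁ x) - fun x => F₂ n x - f₂ x := by
    funext x; simp only [Pi.sub_apply]; abel
  dsimp only
  rw [this]
  exact eLpNorm_sub_le ((hF₁ n).sub hf₁) ((hF₂ n).sub hf₂) hP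

/-- The test function `ramp (u₁ - u₂)` is in `W_0^{1,p}` if `u₁ ≤ u₂` on the boundary. -/
theorem memW01p_ramp_sub {N : ℕ} {p : ℝ} (hp : 1 < p)
    {Ω : Set (EuclideanSpace ℝ (Fin N))} (hΩ : IsOpen Ω) (hΩb : Bornology.IsBounded Ω)
    (hne : Ωᶜ.Nonempty) (hΩL : HasLipschitzBoundary Ω)
    {u₁ u₂ : EuclideanSpace ℝ (Fin N) → ℝ} (h : LeOnBoundary Ω p u₁ u₂) :
    MemW01p Ω p (fun x => ramp (u₁ x - u₂ x)) ∧
      weakGrad Ω (fun x => ramp (u₁ x - u₂ x)) =ᵐ[volume.restrict Ω]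
        fun x => rampDeriv (u₁ x - u₂ x) • (weakGrad Ω u₁ x - weakGrad Ω u₂ x) := by
  obtain ⟨g₁, g₂, ⟨hu₁, hg₁, ψ₁, hψ₁, ⟨hψu₁, hψG₁⟩, hψg₁⟩, ⟨hu₂, hg₂, ψ₂, hψ₂, ⟨hψu₂, hψG₂⟩, hψg₂⟩,
    hg⟩ := h
  set P := ENNReal.ofReal p with hPdef
  have hP : 1 ≤ P := by simpa [P] using hp.le
  have hP0 : P ≠ 0 := (zero_lt_one.trans_le hP).ne'
  set μ := volume.restrict Ω
  have hm : ∀ {E : Type} [NormedAddCommGroup E] [SecondCountableTopology E]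
      {f : EuclideanSpace ℝ (Fin N) → E} {ν : Measure (EuclideanSpace ℝ (Fin N))}, Continuous f →
      AEStronglyMeasurable f ν := fun hf => hf.aestronglyMeasurable
  set v := fun x => u₁ x - u₂ x with hv
  set V := fun x => weakGrad Ω u₁ x - weakGrad Ω u₂ x with hV
  have hvL : MemLp v P μ := hu₁.1.sub hu₂.1
  have hVL : MemLp V P μ := hu₁.2.2.sub hu₂.2.2
  set φ := fun n x => ψ₁ n x - ψ₂ n x with hφ
  have hφc : ∀ n, ContDiff ℝ 1 (φ n) := fun n => (hψ₁ n).sub (hψ₂ n)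
  have hφv : Tendsto (fun n => eLpNorm (fun x => φ n x - v x) P μ) atTop (𝓝 0) :=
    tendsto_eLpNorm_sub_sub hP (fun n => hm (hψ₁ n).continuous) (fun n => hm (hψ₂ n).continuous)
      hu₁.1.1 hu₂.1.1 hψu₁ hψu₂
  have hφgrad : ∀ n x, gradient (φ n) x = gradient (ψ₁ n) x - gradient (ψ₂ n) x := fun n x =>
    gradient_sub ((hψ₁ n).differentiable one_ne_zero x) ((hψ₂ n).differentiable one_ne_zero x)
  have hφV : Tendsto (fun n => eLpNorm (fun x => gradient (φ n) x - V x) P μ) atTop (𝓝 0) := by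
    simp only [hφgrad]
    exact tendsto_eLpNorm_sub_sub hP (fun n => hm (continuous_gradient (hψ₁ n)))
      (fun n => hm (continuous_gradient (hψ₂ n))) hu₁.2.2.1 hu₂.2.2.1 hψG₁ hψG₂
  -- Convergence a.e. along a subsequence is needed because `rampDeriv (φ n) • V` is handled by
  -- dominated convergence.
  obtain ⟨ns, hns, hae⟩ := (tendstoInMeasure_of_tendsto_eLpNorm hP0
    (fun n => hm (hφc n).continuous) hvL.1 hφv).exists_seq_tendsto_ae
  have hnst := hns.tendsto_atTop
  refine memW01p_of_tendsto hp hΩ hΩb hne hΩL (f := fun n x => ramp (φ (ns n) x)) ?_ ?_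
    (fun n => contDiff_ramp.comp (hφc _)) ?_ ?_ ?_
  · refine hvL.of_le (contDiff_ramp.continuous.comp_aestronglyMeasurable hvL.1)
      (Eventually.of_forall fun x => ?_)
    simpa [ramp_zero] using norm_ramp_sub_le (v x) 0
  · refine hVL.of_le ((continuous_rampDeriv.comp_aestronglyMeasurable hvL.1).smul hVL.1)
      (Eventually.of_forall fun x => ?_)
    rw [norm_smul]
    exact mul_le_of_le_one_left (norm_nonneg _) (norm_rampDeriv_le_one _)
  · refine tendsto_of_tendsto_of_tendsto_of_le_of_le tendsto_const_nhds (hφv.comp hnst)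
      (fun _ => zero_le) fun n => eLpNorm_mono fun x => norm_ramp_sub_le _ _
  · have t₁ := tendsto_eLpNorm_of_dominated hp (μ := μ) (V := V)
      (F := fun n x => (rampDeriv (φ (ns n) x) - rampDeriv (v x)) • V x)
      (fun n => ((hm (continuous_rampDeriv.comp (hφc _).continuous)).sub
        (continuous_rampDeriv.comp_aestronglyMeasurable hvL.1)).smul hVL.1) hVL
      (fun n => Eventually.of_forall fun x => by
        rw [norm_smul]
        refine mul_le_of_le_one_left (norm_nonneg _) ?_
        rw [Real.norm_eq_abs, abs_le]
        constructor <;> linarith [rampDeriv_nonneg (φ (ns n) x), rampDeriv_nonneg (v x),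
          rampDeriv_le_one (φ (ns n) x), rampDeriv_le_one (v x)]) (by
        filter_upwards [hae] with x hx
        have h1 := ((continuous_rampDeriv.tendsto _).comp hx).sub_const (rampDeriv (v x))
        have h2 := h1.smul_const (V x)
        simpa using h2)
    have t₂ := (hφV.comp hnst).add t₁
    rw [add_zero] at t₂
    refine tendsto_of_tendsto_of_tendsto_of_le_of_le tendsto_const_nhds t₂ (fun _ => zero_le)
      fun n => ?_
    -- The first term is bounded by the convergence of gradients, since `rampDeriv ≤ 1`; the second
    -- has a fixed `L^p` majorant and tends to zero a.e.
    have heq : (fun x => gradient (fun y => ramp (φ (ns n) y)) x - rampDeriv (v x) • V x) =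
        (fun x => rampDeriv (φ (ns n) x) • (gradient (φ (ns n)) x - V x)) +
          fun x => (rampDeriv (φ (ns n) x) - rampDeriv (v x)) • V x := by
      funext x
      rw [gradient_ramp_comp ((hφc _).differentiable one_ne_zero x)]
      simp only [Pi.add_apply]
      module
    have hkm : AEStronglyMeasurable (fun x => rampDeriv (φ (ns n) x)) μ :=
      hm (continuous_rampDeriv.comp (hφc _).continuous)
    dsimp only
    rw [heq]
    refine (eLpNorm_add_le (hkm.smul ((hm (continuous_gradient (hφc _))).sub hVL.1))
      ((hkm.sub (continuous_rampDeriv.comp_aestronglyMeasurable hvL.1)).smul hVL.1) hP).trans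
      (add_le_add (eLpNorm_mono fun x => ?_) le_rfl)
    rw [Pi.smul_apply', norm_smul]
    exact mul_le_of_le_one_left (norm_nonneg _) (norm_rampDeriv_le_one _)
  · have t := (hψg₁.add hψg₂).comp hnst
    rw [add_zero] at t
    refine tendsto_of_tendsto_of_tendsto_of_le_of_le tendsto_const_nhds t (fun _ => zero_le)
      fun n => ?_
    dsimp only [Function.comp]
    rw [← eLpNorm_norm (fun x => ψ₁ (ns n) x - g₁ x), ← eLpNorm_norm (fun x => ψ₂ (ns n) x - g₂ x)]
    refine (eLpNorm_mono_ae_real ?_).trans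
      (eLpNorm_add_le ((hm (hψ₁ _).continuous).sub hg₁.1).norm
        ((hm (hψ₂ _).continuous).sub hg₂.1).norm hP)
    -- Where `g₁ ≤ g₂`, one has `φ ≤ (ψ₁ - g₁) - (ψ₂ - g₂)`, so the positive part of `φ` is at most
    -- the sum of the two trace errors.
    filter_upwards [hg] with x hx
    simp only [Pi.add_apply]
    rw [Real.norm_of_nonneg (ramp_nonneg _)]
    rcases le_total (φ (ns n) x) 0 with h0 | h0
    · rw [ramp_of_nonpos h0]
      positivity
    · have h1 := norm_ramp_sub_le (φ (ns n) x) 0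
      rw [ramp_zero, sub_zero, sub_zero, Real.norm_of_nonneg (ramp_nonneg _),
        Real.norm_of_nonneg h0] at h1
      have h2 := le_abs_self (ψ₁ (ns n) x - g₁ x)
      have h3 := neg_abs_le (ψ₂ (ns n) x - g₂ x)
      simp only [Real.norm_eq_abs]
      simp only [hφ] at h1 ⊢
      linarith

/-! ### A Poincaré inequality and the zero-gradient conclusion. -/

/-- Integration by parts against `⟪e, x⟫`, whose derivative along `e` is `1` and whose size on `Ω`
is at most `R`. -/
lemma setIntegral_ramp_le {N : ℕ} {Ω : Set (EuclideanSpace ℝ (Fin N))}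
    (hΩ : IsOpen Ω) (hΩb : Bornology.IsBounded Ω)
    {e : EuclideanSpace ℝ (Fin N)} (he : ‖e‖ = 1) {R : ℝ} (hR : ∀ x ∈ Ω, ‖x‖ ≤ R)
    {ψ : EuclideanSpace ℝ (Fin N) → ℝ} (hψ : IsTestFunction Ω ψ) :
    ∫ x in Ω, ramp (ψ x) ≤ R * ∫ x in Ω, ‖gradient ψ x‖ := by
  have hfin := isFiniteMeasure_restrict_of_isBounded hΩb
  set g := fun x => ramp (ψ x) with hg
  have hgc : ContDiff ℝ 1 g := contDiff_ramp.comp hψ.contDiff_one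
  have hgs : HasCompactSupport g := hψ.2.1.comp_left ramp_zero
  have hgΩ : tsupport g ⊆ Ω := (closure_mono (Function.support_comp_subset ramp_zero ψ)).trans hψ.2.2
  have hgΩ' : tsupport (fderiv ℝ g) ⊆ Ω := (tsupport_fderiv_subset ℝ).trans hgΩ
  have hg' : Continuous fun x => fderiv ℝ g x e :=
    (hgc.continuous_fderiv one_ne_zero).clm_apply continuous_const
  have hl : ∀ x, HasFDerivAt (fun x => ⟪e, x⟫) (innerSL ℝ e) x := fun x =>
    (innerSL ℝ e).hasFDerivAt
  have hlc : Continuous fun x : EuclideanSpace ℝ (Fin N) => ⟪e, x⟫ := by fun_prop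
  have hgi : Integrable g := hgc.continuous.integrable_of_hasCompactSupport hgs
  have hparts := integral_mul_fderiv_eq_neg_fderiv_mul_of_integrable (μ := volume)
    (f := fun x => ⟪e, x⟫) (g := g) (v := e)
    (by simpa [(hl _).fderiv, he] using hgi)
    ((hlc.mul hg').integrable_of_hasCompactSupport (hgs.fderiv_apply ℝ e).mul_left)
    ((hlc.mul hgc.continuous).integrable_of_hasCompactSupport hgs.mul_left)
    (fun x _ => (hl x).differentiableAt) (fun x _ => hgc.differentiable one_ne_zero x)
  simp only [(hl _).fderiv, innerSL_apply_apply, real_inner_self_eq_norm_sq, he, one_pow, one_mul]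
    at hparts
  have h1 : ∫ x in Ω, g x = - ∫ x in Ω, ⟪e, x⟫ * fderiv ℝ g x e := by
    rw [setIntegral_eq_integral_of_forall_compl_eq_zero,
      setIntegral_eq_integral_of_forall_compl_eq_zero, hparts, neg_neg]
    · intro x hx
      rw [image_eq_zero_of_notMem_tsupport fun h => hx (hgΩ' h)]
      simp
    · exact fun x hx => image_eq_zero_of_notMem_tsupport fun h => hx (hgΩ h)
  have hgrad : Integrable (fun x => ‖gradient ψ x‖) (volume.restrict Ω) :=
    ((memLp_restrict_of_continuous hΩ hΩb (continuous_gradient hψ.contDiff_one) 1).integrable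
      le_rfl).norm
  rw [h1, ← integral_const_mul]
  refine (le_abs_self _).trans ?_
  rw [abs_neg, ← Real.norm_eq_abs]
  refine norm_integral_le_of_norm_le (hgrad.const_mul R)
    ((ae_restrict_iff' hΩ.measurableSet).2 (Eventually.of_forall fun x hx => ?_))
  rw [norm_mul, ← inner_gradient_left, hg,
    gradient_ramp_comp (hψ.contDiff_one.differentiable one_ne_zero x)]
  have h2 : ‖⟪e, x⟫‖ ≤ R := (norm_inner_le_norm e x).trans (by rw [he, one_mul]; exact hR x hx)
  have h3 : ‖⟪rampDeriv (ψ x) • gradient ψ x, e⟫‖ ≤ ‖gradient ψ x‖ := by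
    refine (norm_inner_le_norm _ _).trans ?_
    rw [he, mul_one, norm_smul]
    exact mul_le_of_le_one_left (norm_nonneg _) (norm_rampDeriv_le_one _)
  exact mul_le_mul h2 h3 (norm_nonneg _) ((norm_nonneg _).trans h2)

/-- A function in `W_0^{1,p}` with vanishing gradient is nonpositive. -/
theorem MemW01p.nonpos_of_weakGrad_eq_zero {N : ℕ} (hN : 1 ≤ N) {p : ℝ} (hp : 1 < p)
    {Ω : Set (EuclideanSpace ℝ (Fin N))} (hΩ : IsOpen Ω) (hΩb : Bornology.IsBounded Ω)
    {w : EuclideanSpace ℝ (Fin N) → ℝ} (hw : MemW01p Ω p w)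
    (h0 : weakGrad Ω w =ᵐ[volume.restrict Ω] 0) : ∀ᵐ x ∂volume.restrict Ω, w x ≤ 0 := by
  have hfin := isFiniteMeasure_restrict_of_isBounded hΩb
  obtain ⟨hw1, ψ, hψ, hψw, hψG⟩ := hw
  have hP : 1 ≤ ENNReal.ofReal p := by simpa using hp.le
  obtain ⟨R, hR⟩ := exists_norm_le_of_isBounded hΩb (continuous_id (X := EuclideanSpace ℝ (Fin N)))
  set e : EuclideanSpace ℝ (Fin N) := EuclideanSpace.single ⟨0, hN⟩ 1
  have he : ‖e‖ = 1 := by simp [e]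
  have hone : ∀ a b : ℝ, ⟪a, b⟫ = b * a := fun a b => by simp
  have hwL : MemLp (fun x => ramp (w x)) (ENNReal.ofReal p) (volume.restrict Ω) := by
    refine hw1.1.of_le (contDiff_ramp.continuous.comp_aestronglyMeasurable hw1.1.1)
      (Eventually.of_forall fun x => ?_)
    simpa [ramp_zero] using norm_ramp_sub_le (w x) 0
  have t₁ : Tendsto (fun n => ∫ x in Ω, ramp (ψ n x)) atTop (𝓝 (∫ x in Ω, ramp (w x))) := by
    have := tendsto_integral_inner (μ := volume.restrict Ω) hP (F := fun n x => ramp (ψ n x))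
      (f := fun x => ramp (w x)) (g := fun _ => 1) (C := 1)
      (fun n => memLp_restrict_of_continuous hΩ hΩb
        (contDiff_ramp.continuous.comp (hψ n).continuous) _) hwL
      (tendsto_of_tendsto_of_tendsto_of_le_of_le tendsto_const_nhds hψw (fun _ => zero_le)
        fun n => eLpNorm_mono fun x => norm_ramp_sub_le _ _)
      aestronglyMeasurable_const (by simp)
    simpa [hone] using this
  -- Since the weak gradient of `w` is zero, convergence in `W^{1,p}` says that the gradients of `ψ
  -- n` tend to zero.
  have t₂ : Tendsto (fun n => R * ∫ x in Ω, ‖gradient (ψ n) x‖) atTop (𝓝 (R * 0)) := by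
    have := tendsto_integral_inner (μ := volume.restrict Ω) hP
      (F := fun n x => ‖gradient (ψ n) x‖) (f := fun x => (0 : ℝ)) (g := fun _ => 1) (C := 1)
      (fun n => memLp_restrict_of_continuous hΩ hΩb
        (continuous_gradient (hψ n).contDiff_one).norm _) (memLp_const 0)
      (hψG.congr fun n => by
        simp only [sub_zero]
        rw [eLpNorm_norm]
        refine eLpNorm_congr_ae ?_
        filter_upwards [h0] with x hx
        simp [hx])
      aestronglyMeasurable_const (by simp)
    refine Tendsto.const_mul R ?_
    simpa [hone] using this
  have hle : ∫ x in Ω, ramp (w x) ≤ 0 := by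
    rw [← mul_zero R]
    exact le_of_tendsto_of_tendsto' t₁ t₂ fun n => setIntegral_ramp_le hΩ hΩb he hR (hψ n)
  have hz := (integral_eq_zero_iff_of_nonneg (fun x => ramp_nonneg (w x))
    (hwL.integrable hP)).1 (le_antisymm hle (integral_nonneg fun x => ramp_nonneg (w x)))
  filter_upwards [hz] with x hx
  by_contra h
  exact (ramp_pos (not_le.1 h)).ne' hx

/-- If `u₁ ≤ u₂` on `∂Ω` and the gradients agree where `u₁ > u₂`, then `u₁ ≤ u₂`. -/
theorem ae_le_of_leOnBoundary {N : ℕ} (hN : 1 ≤ N) {p : ℝ} (hp : 1 < p)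
    {Ω : Set (EuclideanSpace ℝ (Fin N))} (hΩ : IsOpen Ω) (hΩb : Bornology.IsBounded Ω)
    (hne : Ωᶜ.Nonempty) (hΩL : HasLipschitzBoundary Ω)
    {u₁ u₂ : EuclideanSpace ℝ (Fin N) → ℝ} (h : LeOnBoundary Ω p u₁ u₂)
    (hgrad : ∀ᵐ x ∂volume.restrict Ω, u₂ x < u₁ x → weakGrad Ω u₁ x = weakGrad Ω u₂ x) :
    ∀ᵐ x ∂volume.restrict Ω, u₁ x ≤ u₂ x := by
  obtain ⟨hw, hwg⟩ := memW01p_ramp_sub hp hΩ hΩb hne hΩL h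
  have h0 : weakGrad Ω (fun x => ramp (u₁ x - u₂ x)) =ᵐ[volume.restrict Ω] 0 := by
    filter_upwards [hwg, hgrad] with x hx hx'
    rw [hx]
    rcases le_or_gt (u₁ x) (u₂ x) with hle | hlt
    · simp [rampDeriv_of_nonpos (sub_nonpos.2 hle)]
    · simp [hx' hlt]
  filter_upwards [hw.nonpos_of_weakGrad_eq_zero hN hp hΩ hΩb h0] with x hx
  by_contra hlt
  exact (ramp_pos (sub_pos.2 (not_le.1 hlt))).not_ge hx

/-! ### Subgradients of the norm and strict convexity. -/

/-- The subgradient inequality at `η + ξ` with subadditivity: subgradients lie in the dual unit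
ball. -/
lemma inner_le_of_mem_subdifferential {N : ℕ} {F : Seminorm ℝ (EuclideanSpace ℝ (Fin N))}
    {ξ δ : EuclideanSpace ℝ (Fin N)} (h : δ ∈ subdifferential F ξ)
    (η : EuclideanSpace ℝ (Fin N)) : ⟪δ, η⟫ ≤ F η := by
  have h1 := h (η + ξ)
  rw [add_sub_cancel_right] at h1
  linarith [map_add_le_add F η ξ]

/-- The subgradient inequality at `0` gives `≥`, the dual ball bound gives `≤`. -/
lemma inner_self_of_mem_subdifferential {N : ℕ} {F : Seminorm ℝ (EuclideanSpace ℝ (Fin N))}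
    {ξ δ : EuclideanSpace ℝ (Fin N)} (h : δ ∈ subdifferential F ξ) : ⟪δ, ξ⟫ = F ξ := by
  have h1 := h 0
  rw [zero_sub, inner_neg_right, map_zero] at h1
  linarith [inner_le_of_mem_subdifferential h ξ]

lemma abs_inner_le_of_mem_subdifferential {N : ℕ} {F : Seminorm ℝ (EuclideanSpace ℝ (Fin N))}
    {ξ δ : EuclideanSpace ℝ (Fin N)} (h : δ ∈ subdifferential F ξ)
    (η : EuclideanSpace ℝ (Fin N)) : |⟪δ, η⟫| ≤ F η := by
  refine abs_le.2 ⟨?_, inner_le_of_mem_subdifferential h η⟩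
  have h1 := inner_le_of_mem_subdifferential h (-η)
  rw [inner_neg_right, map_neg_eq_map] at h1
  linarith

/-- After scaling to norm one, the midpoint lies in the interior of the unit ball, so a slight
dilation of it by `t > 1` still has norm at most one. -/
lemma IsStrictlyConvexNorm.map_add_lt {N : ℕ} {F : Seminorm ℝ (EuclideanSpace ℝ (Fin N))}
    (hF : IsStrictlyConvexNorm F) {ξ₁ ξ₂ : EuclideanSpace ℝ (Fin N)} (h : F ξ₁ = F ξ₂)
    (hne : ξ₁ ≠ ξ₂) : F (ξ₁ + ξ₂) < 2 * F ξ₁ := by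
  have ha : 0 < F ξ₁ := by
    refine (apply_nonneg F ξ₁).lt_of_ne fun h0 => hne ?_
    rw [hF.1 ξ₁ h0.symm, hF.1 ξ₂ (by rw [← h, ← h0])]
  set a := F ξ₁ with hadef
  have hscale : ∀ (c : ℝ) (ξ : EuclideanSpace ℝ (Fin N)), 0 ≤ c → F (c • ξ) = c * F ξ :=
    fun c ξ hc => by rw [map_smul_eq_mul, Real.norm_of_nonneg hc]
  have hm : ∀ ξ, F ξ = a → a⁻¹ • ξ ∈ {ξ | F ξ ≤ 1} := fun ξ hξ => by
    change F (a⁻¹ • ξ) ≤ 1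
    rw [hscale _ _ (by positivity), hξ, inv_mul_cancel₀ ha.ne']
  have hint := hF.2 (hm ξ₁ rfl) (hm ξ₂ h.symm)
    (fun h' => hne (smul_right_injective _ (inv_ne_zero ha.ne') h'))
    (by norm_num : (0 : ℝ) < 1 / 2) (by norm_num : (0 : ℝ) < 1 / 2) (by norm_num)
  set z := (1 / 2 : ℝ) • a⁻¹ • ξ₁ + (1 / 2 : ℝ) • a⁻¹ • ξ₂ with hz
  have hc : Tendsto (fun t : ℝ => t • z) (𝓝[>] 1) (𝓝 z) := by
    have : Continuous fun t : ℝ => t • z := by fun_prop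
    simpa using (this.tendsto 1).mono_left nhdsWithin_le_nhds
  obtain ⟨t, ht, ht1⟩ := ((hc.eventually (isOpen_interior.mem_nhds hint)).and
    self_mem_nhdsWithin).exists
  have ht1' : (1 : ℝ) < t := ht1
  have ht2 : F (t • z) ≤ 1 := by
    have h : t • z ∈ {ξ | F ξ ≤ 1} := interior_subset ht
    exact h
  rw [hscale _ _ (by linarith)] at ht2
  have hz2 : z = (1 / 2 * a⁻¹) • (ξ₁ + ξ₂) := by rw [hz]; module
  rw [hz2, hscale _ _ (by positivity)] at ht2
  have h3 : 1 / 2 * a⁻¹ * F (ξ₁ + ξ₂) < 1 := by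
    by_contra hcon
    have := not_lt.1 hcon
    nlinarith
  have h4 : F (ξ₁ + ξ₂) = 2 * a * (1 / 2 * a⁻¹ * F (ξ₁ + ξ₂)) := by field_simp
  rw [h4]
  have h5 : 0 < 2 * a := by positivity
  nlinarith

lemma rpow_sub_one_mul_self {p a : ℝ} (hp : 1 < p) (ha : 0 ≤ a) : a ^ (p - 1) * a = a ^ p := by
  rcases ha.eq_or_lt with rfl | h
  · rw [mul_zero, Real.zero_rpow (by linarith)]
  · rw [← Real.rpow_add_one h.ne', sub_add_cancel]

/-- Monotonicity of `ξ ↦ F^{p-1}(ξ) ∂F(ξ)`, with the equality case. -/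
lemma IsStrictlyConvexNorm.flux_monotone {N : ℕ} {F : Seminorm ℝ (EuclideanSpace ℝ (Fin N))}
    (hF : IsStrictlyConvexNorm F) {p : ℝ} (hp : 1 < p)
    {ξ₁ ξ₂ δ₁ δ₂ : EuclideanSpace ℝ (Fin N)} (h₁ : δ₁ ∈ subdifferential F ξ₁)
    (h₂ : δ₂ ∈ subdifferential F ξ₂) :
    0 ≤ ⟪F ξ₁ ^ (p - 1) • δ₁ - F ξ₂ ^ (p - 1) • δ₂, ξ₁ - ξ₂⟫ ∧
      (⟪F ξ₁ ^ (p - 1) • δ₁ - F ξ₂ ^ (p - 1) • δ₂, ξ₁ - ξ₂⟫ = 0 → ξ₁ = ξ₂) := by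
  have ha := apply_nonneg F ξ₁
  have hb := apply_nonneg F ξ₂
  have hp1 : 0 < p - 1 := by linarith
  have e₁ := inner_self_of_mem_subdifferential h₁
  have e₂ := inner_self_of_mem_subdifferential h₂
  have l₁ := inner_le_of_mem_subdifferential h₁ ξ₂
  have l₂ := inner_le_of_mem_subdifferential h₂ ξ₁
  have hA : 0 ≤ F ξ₁ ^ (p - 1) := Real.rpow_nonneg ha _
  have hB : 0 ≤ F ξ₂ ^ (p - 1) := Real.rpow_nonneg hb _
  -- Each term is nonnegative: the first by monotonicity of `t ↦ t^(p-1)`, strictly if the norms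
  -- differ, the other two by the dual ball bound.
  have hexp : ⟪F ξ₁ ^ (p - 1) • δ₁ - F ξ₂ ^ (p - 1) • δ₂, ξ₁ - ξ₂⟫ =
      (F ξ₁ ^ (p - 1) - F ξ₂ ^ (p - 1)) * (F ξ₁ - F ξ₂) +
      F ξ₁ ^ (p - 1) * (F ξ₂ - ⟪δ₁, ξ₂⟫) + F ξ₂ ^ (p - 1) * (F ξ₁ - ⟪δ₂, ξ₁⟫) := by
    simp only [inner_sub_left, inner_sub_right, real_inner_smul_left, e₁, e₂]
    ring
  have t₁ : 0 ≤ F ξ₁ ^ (p - 1) * (F ξ₂ - ⟪δ₁, ξ₂⟫) := mul_nonneg hA (by linarith)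
  have t₂ : 0 ≤ F ξ₂ ^ (p - 1) * (F ξ₁ - ⟪δ₂, ξ₁⟫) := mul_nonneg hB (by linarith)
  have t₀ : F ξ₁ ≠ F ξ₂ → 0 < (F ξ₁ ^ (p - 1) - F ξ₂ ^ (p - 1)) * (F ξ₁ - F ξ₂) := by
    intro hne
    rcases hne.lt_or_gt with h | h
    · have := Real.rpow_lt_rpow ha h hp1
      exact mul_pos_of_neg_of_neg (by linarith) (by linarith)
    · have := Real.rpow_lt_rpow hb h hp1
      exact mul_pos (by linarith) (by linarith)
  rw [hexp]
  by_cases hab : F ξ₁ = F ξ₂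
  · have t₃ : (F ξ₁ ^ (p - 1) - F ξ₂ ^ (p - 1)) * (F ξ₁ - F ξ₂) = 0 := by rw [hab]; simp
    refine ⟨by linarith, fun h0 => ?_⟩
    by_contra hne
    have hlt := hF.map_add_lt hab hne
    have hpos : 0 < F ξ₁ := by
      refine ha.lt_of_ne fun h0 => hne ?_
      rw [hF.1 ξ₁ h0.symm, hF.1 ξ₂ (by rw [← hab, ← h0])]
    -- With equal norms, `F ξ₁ + ⟪δ₁, ξ₂⟫ ≤ F (ξ₁ + ξ₂) < 2 * F ξ₁`, so `⟪δ₁, ξ₂⟫ < F ξ₂` and the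
    -- second term is strictly positive.
    have h5 := inner_le_of_mem_subdifferential h₁ (ξ₁ + ξ₂)
    rw [inner_add_right, e₁] at h5
    have h6 : 0 < F ξ₁ ^ (p - 1) * (F ξ₂ - ⟪δ₁, ξ₂⟫) :=
      mul_pos (Real.rpow_pos_of_pos hpos _) (by linarith)
    linarith
  · have := t₀ hab
    exact ⟨by linarith, fun h0 => by linarith⟩

/-- Midpoint convexity of `F^p`, with the equality case. -/
lemma IsStrictlyConvexNorm.rpow_midpoint_le {N : ℕ} {F : Seminorm ℝ (EuclideanSpace ℝ (Fin N))}
    (hF : IsStrictlyConvexNorm F) {p : ℝ} (hp : 1 < p) (ξ₁ ξ₂ : EuclideanSpace ℝ (Fin N)) :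
    F ((1 / 2 : ℝ) • (ξ₁ + ξ₂)) ^ p ≤ 1 / 2 * F ξ₁ ^ p + 1 / 2 * F ξ₂ ^ p ∧
      (F ((1 / 2 : ℝ) • (ξ₁ + ξ₂)) ^ p = 1 / 2 * F ξ₁ ^ p + 1 / 2 * F ξ₂ ^ p → ξ₁ = ξ₂) := by
  have ha := apply_nonneg F ξ₁
  have hb := apply_nonneg F ξ₂
  have hp0 : 0 < p := by linarith
  have hm : F ((1 / 2 : ℝ) • (ξ₁ + ξ₂)) = 1 / 2 * F (ξ₁ + ξ₂) := by
    rw [map_smul_eq_mul, Real.norm_of_nonneg (by norm_num)]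
  have h1 : 1 / 2 * F (ξ₁ + ξ₂) ≤ 1 / 2 * F ξ₁ + 1 / 2 * F ξ₂ := by
    linarith [map_add_le_add F ξ₁ ξ₂]
  have h0 : 0 ≤ 1 / 2 * F (ξ₁ + ξ₂) := mul_nonneg (by norm_num) (apply_nonneg F _)
  rw [hm]
  -- Equal norms use strict convexity of the ball; different norms use strict convexity of `t ↦
  -- t^p`.
  by_cases hab : F ξ₁ = F ξ₂
  · have h2 : 1 / 2 * F ξ₁ ^ p + 1 / 2 * F ξ₂ ^ p = F ξ₁ ^ p := by rw [hab]; ring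
    rw [h2]
    refine ⟨Real.rpow_le_rpow h0 (by linarith) hp0.le, fun heq => ?_⟩
    by_contra hne
    have h3 := hF.map_add_lt hab hne
    exact (Real.rpow_lt_rpow h0 (by linarith : 1 / 2 * F (ξ₁ + ξ₂) < F ξ₁) hp0).ne heq
  · have h2 := Real.rpow_le_rpow h0 h1 hp0.le
    have h3 := (strictConvexOn_rpow hp).2 (Set.mem_Ici.2 ha) (Set.mem_Ici.2 hb) hab
      (by norm_num : (0 : ℝ) < 1 / 2) (by norm_num : (0 : ℝ) < 1 / 2) (by norm_num)
    simp only [smul_eq_mul] at h3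
    exact ⟨by linarith, fun heq => by linarith⟩

lemma continuous_seminorm {N : ℕ} (F : Seminorm ℝ (EuclideanSpace ℝ (Fin N))) : Continuous F :=
  F.convexOn.locallyLipschitz.continuous

lemma memLp_seminorm_comp {N : ℕ} (F : Seminorm ℝ (EuclideanSpace ℝ (Fin N))) {α : Type*}
    [MeasurableSpace α] {μ : Measure α} {P : ℝ≥0∞} {V : α → EuclideanSpace ℝ (Fin N)}
    (hV : MemLp V P μ) : MemLp (fun x => F (V x)) P μ := by
  obtain ⟨C, -, hC⟩ := F.bound_of_continuous_normedSpace (continuous_seminorm F)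
  refine hV.of_le_mul (c := C) ((continuous_seminorm F).comp_aestronglyMeasurable hV.1)
    (Eventually.of_forall fun x => ?_)
  rw [Real.norm_of_nonneg (apply_nonneg F _)]
  exact hC _

lemma integrable_seminorm_rpow {N : ℕ} (F : Seminorm ℝ (EuclideanSpace ℝ (Fin N))) {α : Type*}
    [MeasurableSpace α] {μ : Measure α} {p : ℝ} (hp : 1 < p) {V : α → EuclideanSpace ℝ (Fin N)}
    (hV : MemLp V (ENNReal.ofReal p) μ) : Integrable (fun x => F (V x) ^ p) μ := by
  have hp0 : 0 < p := by linarith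
  have h := (memLp_seminorm_comp F hV).integrable_norm_rpow (by simpa using hp0)
    ENNReal.ofReal_ne_top
  rw [ENNReal.toReal_ofReal hp0.le] at h
  simpa only [Real.norm_of_nonneg (apply_nonneg F _)] using h

/-- The dual ball bound gives `a^(p-1) * b` with `a = F(∇u)` and `b = F(V)`, which is at most `a^p +
b^p` by comparing `a` with `b`. -/
lemma integrable_inner_flux {N : ℕ} {Ω : Set (EuclideanSpace ℝ (Fin N))} {p : ℝ} (hp : 1 < p)
    {F : Seminorm ℝ (EuclideanSpace ℝ (Fin N))} {u : EuclideanSpace ℝ (Fin N) → ℝ}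
    {z V : EuclideanSpace ℝ (Fin N) → EuclideanSpace ℝ (Fin N)} (hu : MemW1p Ω p u)
    (hz : IsSelection Ω F u z) (hV : MemLp V (ENNReal.ofReal p) (volume.restrict Ω)) :
    Integrable (fun x => ⟪flux Ω p F u z x, V x⟫) (volume.restrict Ω) := by
  have hu' := hu.2.2
  have hFm : AEStronglyMeasurable (fun x => F (weakGrad Ω u x)) (volume.restrict Ω) :=
    (memLp_seminorm_comp F hu').1
  have hflux : AEStronglyMeasurable (flux Ω p F u z) (volume.restrict Ω) :=
    (hFm.aemeasurable.pow_const (p - 1)).aestronglyMeasurable.smul hz.1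
  refine ((integrable_seminorm_rpow F hp hu').add (integrable_seminorm_rpow F hp hV)).mono'
    (hflux.inner hV.1) ?_
  filter_upwards [hz.2] with x hx
  set a := F (weakGrad Ω u x)
  have ha : 0 ≤ a := apply_nonneg F _
  have hb : 0 ≤ F (V x) := apply_nonneg F _
  have h1 : ‖⟪flux Ω p F u z x, V x⟫‖ ≤ a ^ (p - 1) * F (V x) := by
    rw [flux, real_inner_smul_left, norm_mul, Real.norm_of_nonneg (Real.rpow_nonneg ha _)]
    exact mul_le_mul_of_nonneg_left (abs_inner_le_of_mem_subdifferential hx _)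
      (Real.rpow_nonneg ha _)
  refine h1.trans ?_
  simp only [Pi.add_apply]
  have hap := Real.rpow_nonneg ha p
  have hbp := Real.rpow_nonneg hb p
  rcases le_total a (F (V x)) with h | h
  · have h2 : a ^ (p - 1) * F (V x) ≤ F (V x) ^ (p - 1) * F (V x) :=
      mul_le_mul_of_nonneg_right (Real.rpow_le_rpow ha h (by linarith)) hb
    rw [rpow_sub_one_mul_self hp hb] at h2
    linarith
  · have h2 : a ^ (p - 1) * F (V x) ≤ a ^ (p - 1) * a :=
      mul_le_mul_of_nonneg_left h (Real.rpow_nonneg ha _)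
    rw [rpow_sub_one_mul_self hp ha] at h2
    linarith

/-! ### Comparison, then uniqueness of minimizers. -/

/-- The comparison principle. -/
theorem comparison {N : ℕ} (hN : 1 ≤ N) {p : ℝ} (hp : 1 < p)
    {Ω : Set (EuclideanSpace ℝ (Fin N))} (hΩ : IsOpen Ω) (hΩb : Bornology.IsBounded Ω)
    (hne : Ωᶜ.Nonempty) (hΩL : HasLipschitzBoundary Ω)
    {F : Seminorm ℝ (EuclideanSpace ℝ (Fin N))} (hF : IsStrictlyConvexNorm F)
    {u₁ u₂ : EuclideanSpace ℝ (Fin N) → ℝ}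
    {z₁ z₂ : EuclideanSpace ℝ (Fin N) → EuclideanSpace ℝ (Fin N)}
    (hu₁ : MemW1p Ω p u₁) (hu₂ : MemW1p Ω p u₂)
    (hz₁ : IsSelection Ω F u₁ z₁) (hz₂ : IsSelection Ω F u₂ z₂)
    (hdiv : WeakDivGE Ω p (flux Ω p F u₁ z₁) (flux Ω p F u₂ z₂))
    (hle : LeOnBoundary Ω p u₁ u₂) : ∀ᵐ x ∂volume.restrict Ω, u₁ x ≤ u₂ x := by
  obtain ⟨hw, hwg⟩ := memW01p_ramp_sub hp hΩ hΩb hne hΩL hle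
  have hW := hw.1.2.2
  set W := weakGrad Ω (fun x => ramp (u₁ x - u₂ x))
  have hi₁ := integrable_inner_flux hp hu₁ hz₁ hW
  have hi₂ := integrable_inner_flux hp hu₂ hz₂ hW
  have hint := hdiv _ hw (Eventually.of_forall fun x => ramp_nonneg _)
  have heq : ∀ᵐ x ∂volume.restrict Ω,
      ⟪flux Ω p F u₁ z₁ x, W x⟫ - ⟪flux Ω p F u₂ z₂ x, W x⟫ = rampDeriv (u₁ x - u₂ x) *
        ⟪F (weakGrad Ω u₁ x) ^ (p - 1) • z₁ x - F (weakGrad Ω u₂ x) ^ (p - 1) • z₂ x,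
          weakGrad Ω u₁ x - weakGrad Ω u₂ x⟫ := by
    filter_upwards [hwg] with x hx
    rw [← inner_sub_left, hx, real_inner_smul_right]
    rfl
  have hnn : 0 ≤ᵐ[volume.restrict Ω]
      fun x => ⟪flux Ω p F u₁ z₁ x, W x⟫ - ⟪flux Ω p F u₂ z₂ x, W x⟫ := by
    filter_upwards [heq, hz₁.2, hz₂.2] with x hx h1 h2
    rw [hx]
    exact mul_nonneg (rampDeriv_nonneg _) (hF.flux_monotone hp h1 h2).1
  -- The weak inequality makes the integral of this nonnegative function at most zero.
  have hzero := (integral_eq_zero_iff_of_nonneg_ae hnn (hi₁.sub hi₂)).1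
    (le_antisymm (by rw [integral_sub hi₁ hi₂]; linarith) (integral_nonneg_of_ae hnn))
  refine ae_le_of_leOnBoundary hN hp hΩ hΩb hne hΩL hle ?_
  filter_upwards [heq, hzero, hz₁.2, hz₂.2] with x hx h0 h1 h2 hlt
  rw [Pi.zero_apply, hx] at h0
  exact (hF.flux_monotone hp h1 h2).2
    ((mul_eq_zero.1 h0).resolve_left (rampDeriv_pos (sub_pos.2 hlt)).ne')

lemma tendsto_eLpNorm_midpoint {α E : Type*} [MeasurableSpace α] {μ : Measure α}
    [NormedAddCommGroup E] [NormedSpace ℝ E] {P : ℝ≥0∞} (hP : 1 ≤ P) {F₁ F₂ : ℕ → α → E}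
    {f₁ f₂ : α → E}
    (hF₁ : ∀ n, AEStronglyMeasurable (F₁ n) μ) (hF₂ : ∀ n, AEStronglyMeasurable (F₂ n) μ)
    (hf₁ : AEStronglyMeasurable f₁ μ) (hf₂ : AEStronglyMeasurable f₂ μ)
    (h₁ : Tendsto (fun n => eLpNorm (fun x => F₁ n x - f₁ x) P μ) atTop (𝓝 0))
    (h₂ : Tendsto (fun n => eLpNorm (fun x => F₂ n x - f₂ x) P μ) atTop (𝓝 0)) :
    Tendsto (fun n => eLpNorm (fun x => (1 / 2 : ℝ) • (F₁ n x + F₂ n x) -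
      (1 / 2 : ℝ) • (f₁ x + f₂ x)) P μ) atTop (𝓝 0) := by
  have h3 := h₁.add h₂
  rw [add_zero] at h3
  refine tendsto_of_tendsto_of_tendsto_of_le_of_le tendsto_const_nhds h3 (fun _ => zero_le)
    fun n => ?_
  refine le_trans (eLpNorm_mono (g := (fun x => F₁ n x - f₁ x) + fun x => F₂ n x - f₂ x)
    fun x => ?_) (eLpNorm_add_le ((hF₁ n).sub hf₁) ((hF₂ n).sub hf₂) hP)
  have : (1 / 2 : ℝ) • (F₁ n x + F₂ n x) - (1 / 2 : ℝ) • (f₁ x + f₂ x) =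
      (1 / 2 : ℝ) • (F₁ n x - f₁ x + (F₂ n x - f₂ x)) := by module
  rw [this, norm_smul]
  exact mul_le_of_le_one_left (norm_nonneg _) (by norm_num)

/-- Makes the midpoint an admissible competitor: averaging the two approximating sequences yields
its weak gradient and its trace together. -/
lemma HasTrace.midpoint {N : ℕ} {p : ℝ} (hp : 1 < p)
    {Ω : Set (EuclideanSpace ℝ (Fin N))} (hΩ : IsOpen Ω) (hΩb : Bornology.IsBounded Ω)
    {u₁ u₂ φ : EuclideanSpace ℝ (Fin N) → ℝ} (h₁ : HasTrace Ω p u₁ φ) (h₂ : HasTrace Ω p u₂ φ) :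
    HasTrace Ω p (fun x => (1 / 2 : ℝ) • (u₁ x + u₂ x)) φ ∧
      weakGrad Ω (fun x => (1 / 2 : ℝ) • (u₁ x + u₂ x)) =ᵐ[volume.restrict Ω]
        fun x => (1 / 2 : ℝ) • (weakGrad Ω u₁ x + weakGrad Ω u₂ x) := by
  obtain ⟨hu₁, hg, ψ₁, hψ₁, ⟨hψu₁, hψG₁⟩, hψg₁⟩ := h₁
  obtain ⟨hu₂, -, ψ₂, hψ₂, ⟨hψu₂, hψG₂⟩, hψg₂⟩ := h₂
  have hP : 1 ≤ ENNReal.ofReal p := by simpa using hp.le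
  set f : ℕ → EuclideanSpace ℝ (Fin N) → ℝ := fun n x => (1 / 2 : ℝ) • (ψ₁ n x + ψ₂ n x) with hfdef
  have hf : ∀ n, ContDiff ℝ 1 (f n) := fun n => ((hψ₁ n).add (hψ₂ n)).const_smul _
  have hfg : ∀ n x, gradient (f n) x =
      (1 / 2 : ℝ) • (gradient (ψ₁ n) x + gradient (ψ₂ n) x) := fun n x => by
    have d₁ := (hψ₁ n).differentiable one_ne_zero x
    have d₂ := (hψ₂ n).differentiable one_ne_zero x
    have : fderiv ℝ (f n) x = (1 / 2 : ℝ) • (fderiv ℝ (ψ₁ n) x + fderiv ℝ (ψ₂ n) x) :=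
      ((d₁.hasFDerivAt.add d₂.hasFDerivAt).const_smul (1 / 2 : ℝ)).fderiv
    simp only [gradient, this]
    simp
  have hwL : MemLp (fun x => (1 / 2 : ℝ) • (u₁ x + u₂ x)) (ENNReal.ofReal p)
      (volume.restrict Ω) := (hu₁.1.add hu₂.1).const_smul (1 / 2 : ℝ)
  have hHL : MemLp (fun x => (1 / 2 : ℝ) • (weakGrad Ω u₁ x + weakGrad Ω u₂ x))
      (ENNReal.ofReal p) (volume.restrict Ω) := (hu₁.2.2.add hu₂.2.2).const_smul (1 / 2 : ℝ)
  have t₁ := tendsto_eLpNorm_midpoint hP (fun n => (hψ₁ n).continuous.aestronglyMeasurable)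
    (fun n => (hψ₂ n).continuous.aestronglyMeasurable) hu₁.1.1 hu₂.1.1 hψu₁ hψu₂
  have t₂ := tendsto_eLpNorm_midpoint hP
    (fun n => (continuous_gradient (hψ₁ n)).aestronglyMeasurable)
    (fun n => (continuous_gradient (hψ₂ n)).aestronglyMeasurable) hu₁.2.2.1 hu₂.2.2.1 hψG₁ hψG₂
  have t₃ := tendsto_eLpNorm_midpoint hP (fun n => (hψ₁ n).continuous.aestronglyMeasurable)
    (fun n => (hψ₂ n).continuous.aestronglyMeasurable) hg.1 hg.1 hψg₁ hψg₂
  simp only [← hfg] at t₂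
  have hwg := hasWeakGradient_of_tendsto hp hΩ hΩb hwL hHL hf t₁ t₂
  have hae := hwg.weakGrad_ae_eq hΩ
  refine ⟨⟨memW1p_of_hasWeakGradient hΩ hwL hHL hwg, hg, f, hf,
    tendstoW1p_of_weakGrad_ae_eq hae t₁ t₂, ?_⟩, hae⟩
  refine t₃.congr fun n => ?_
  congr 1
  funext x
  simp only [hfdef, smul_eq_mul]
  ring

lemma energy_eq_ofReal_integral {N : ℕ} {p : ℝ} (hp : 1 < p)
    {Ω : Set (EuclideanSpace ℝ (Fin N))} (F : Seminorm ℝ (EuclideanSpace ℝ (Fin N)))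
    {φ u : EuclideanSpace ℝ (Fin N) → ℝ} (h : HasTrace Ω p u φ) :
    energy Ω p F φ u = ENNReal.ofReal (∫ x in Ω, F (weakGrad Ω u x) ^ p) := by
  rw [energy, if_pos h, ofReal_integral_eq_lintegral_ofReal
    (integrable_seminorm_rpow F hp h.1.2.2)
    (Eventually.of_forall fun x => Real.rpow_nonneg (apply_nonneg F _) _)]

/-- The admissible `v` has finite energy, so a minimizer cannot have energy `⊤`. -/
lemma IsMinimizer.hasTrace {N : ℕ} {p : ℝ} (hp : 1 < p)
    {Ω : Set (EuclideanSpace ℝ (Fin N))} {F : Seminorm ℝ (EuclideanSpace ℝ (Fin N))}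
    {φ u v : EuclideanSpace ℝ (Fin N) → ℝ} (hv : HasTrace Ω p v φ)
    (hu : IsMinimizer Ω p F φ u) : HasTrace Ω p u φ := by
  by_contra h
  have h1 := hu.2 v hv.1.1
  rw [energy_eq_ofReal_integral hp F hv, energy, if_neg h] at h1
  exact ENNReal.ofReal_ne_top (top_le_iff.1 h1)

/-- The midpoint has energy no smaller than either minimizer, so the nonnegative convexity gap
integrates to zero; its equality case identifies the gradients. -/
lemma IsMinimizer.weakGrad_ae_eq {N : ℕ} {p : ℝ} (hp : 1 < p)
    {Ω : Set (EuclideanSpace ℝ (Fin N))} (hΩ : IsOpen Ω) (hΩb : Bornology.IsBounded Ω)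
    {F : Seminorm ℝ (EuclideanSpace ℝ (Fin N))} (hF : IsStrictlyConvexNorm F)
    {φ u₁ u₂ : EuclideanSpace ℝ (Fin N) → ℝ} (ht₁ : HasTrace Ω p u₁ φ) (ht₂ : HasTrace Ω p u₂ φ)
    (h₁ : IsMinimizer Ω p F φ u₁) (h₂ : IsMinimizer Ω p F φ u₂) :
    weakGrad Ω u₁ =ᵐ[volume.restrict Ω] weakGrad Ω u₂ := by
  obtain ⟨htm, hae⟩ := ht₁.midpoint hp hΩ hΩb ht₂
  set m := fun x => (1 / 2 : ℝ) • (u₁ x + u₂ x)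
  have i₁ := integrable_seminorm_rpow F hp ht₁.1.2.2
  have i₂ := integrable_seminorm_rpow F hp ht₂.1.2.2
  have im := integrable_seminorm_rpow F hp htm.1.2.2
  have hnn : ∀ u : EuclideanSpace ℝ (Fin N) → ℝ, 0 ≤ ∫ x in Ω, F (weakGrad Ω u x) ^ p := fun u =>
    integral_nonneg fun x => Real.rpow_nonneg (apply_nonneg F _) _
  have hcmp : ∀ {u w : EuclideanSpace ℝ (Fin N) → ℝ}, HasTrace Ω p u φ → HasTrace Ω p w φ →
      IsMinimizer Ω p F φ u →
      ∫ x in Ω, F (weakGrad Ω u x) ^ p ≤ ∫ x in Ω, F (weakGrad Ω w x) ^ p := by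
    intro u w hu hw hmin
    have h := hmin.2 w hw.1.1
    rw [energy_eq_ofReal_integral hp F hu, energy_eq_ofReal_integral hp F hw] at h
    exact (ENNReal.ofReal_le_ofReal_iff (hnn w)).1 h
  have hm₁ := hcmp ht₁ htm h₁
  have hm₂ := hcmp ht₂ htm h₂
  have hgap : 0 ≤ᵐ[volume.restrict Ω] fun x => (1 / 2 * F (weakGrad Ω u₁ x) ^ p +
      1 / 2 * F (weakGrad Ω u₂ x) ^ p) - F (weakGrad Ω m x) ^ p := by
    filter_upwards [hae] with x hx
    rw [hx]
    exact sub_nonneg.2 (hF.rpow_midpoint_le hp _ _).1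
  have is : Integrable (fun x => 1 / 2 * F (weakGrad Ω u₁ x) ^ p +
      1 / 2 * F (weakGrad Ω u₂ x) ^ p) (volume.restrict Ω) := (i₁.const_mul (1 / 2)).add (i₂.const_mul (1 / 2))
  have hint : ∫ x in Ω, ((1 / 2 * F (weakGrad Ω u₁ x) ^ p +
      1 / 2 * F (weakGrad Ω u₂ x) ^ p) - F (weakGrad Ω m x) ^ p) ≤ 0 := by
    rw [integral_sub is im, integral_add (i₁.const_mul _) (i₂.const_mul _),
      integral_const_mul, integral_const_mul]
    linarith
  have hzero := (integral_eq_zero_iff_of_nonneg_ae hgap (is.sub im)).1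
    (le_antisymm hint (integral_nonneg_of_ae hgap))
  filter_upwards [hzero, hae] with x hx hx'
  rw [Pi.zero_apply, hx', sub_eq_zero] at hx
  exact (hF.rpow_midpoint_le hp _ _).2 hx.symm

lemma HasTrace.leOnBoundary {N : ℕ} {p : ℝ} {Ω : Set (EuclideanSpace ℝ (Fin N))}
    {u₁ u₂ φ : EuclideanSpace ℝ (Fin N) → ℝ} (h₁ : HasTrace Ω p u₁ φ) (h₂ : HasTrace Ω p u₂ φ) :
    LeOnBoundary Ω p u₁ u₂ :=
  ⟨φ, φ, h₁, h₂, Eventually.of_forall fun _ => le_rfl⟩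

/-- Needed because `Metric.infDist` to the empty set is `0` by convention, which would make every
strip of positive width all of `Ω`. -/
lemma nonempty_compl_of_isBounded {N : ℕ} (hN : 1 ≤ N) {Ω : Set (EuclideanSpace ℝ (Fin N))}
    (hΩb : Bornology.IsBounded Ω) : Ωᶜ.Nonempty := by
  have : Nonempty (Fin N) := ⟨⟨0, hN⟩⟩
  rw [Set.nonempty_compl]
  rintro rfl
  exact NormedSpace.unbounded_univ ℝ (EuclideanSpace ℝ (Fin N)) hΩb

end AnisotropicComparison

end

theorem mainTheorem7 {N : ℕ} (hN : 1 ≤ N) {p : ℝ} (hp : 1 < p)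
    {Ω : Set (EuclideanSpace ℝ (Fin N))} (hΩ : IsOpen Ω) (hΩb : Bornology.IsBounded Ω)
    (hΩL : AnisotropicComparison.HasLipschitzBoundary Ω)
    {F : Seminorm ℝ (EuclideanSpace ℝ (Fin N))}
    (hF : AnisotropicComparison.IsStrictlyConvexNorm F) :
    (∀ (u₁ u₂ : EuclideanSpace ℝ (Fin N) → ℝ)
        (z₁ z₂ : EuclideanSpace ℝ (Fin N) → EuclideanSpace ℝ (Fin N)),
      AnisotropicComparison.MemW1p Ω p u₁ →
      AnisotropicComparison.MemW1p Ω p u₂ →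
      AnisotropicComparison.IsSelection Ω F u₁ z₁ →
      AnisotropicComparison.IsSelection Ω F u₂ z₂ →
      AnisotropicComparison.WeakDivGE Ω p (AnisotropicComparison.flux Ω p F u₁ z₁)
        (AnisotropicComparison.flux Ω p F u₂ z₂) →
      AnisotropicComparison.LeOnBoundary Ω p u₁ u₂ →
      ∀ᵐ x ∂(volume.restrict Ω), u₁ x ≤ u₂ x) ∧
    (∀ φ : EuclideanSpace ℝ (Fin N) → ℝ, (∃ v, AnisotropicComparison.HasTrace Ω p v φ) →
      (∀ u₁ u₂ : EuclideanSpace ℝ (Fin N) → ℝ,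
        AnisotropicComparison.IsMinimizer Ω p F φ u₁ →
        AnisotropicComparison.IsMinimizer Ω p F φ u₂ →
        ∀ᵐ x ∂(volume.restrict Ω), u₁ x = u₂ x) ∧
      (∀ u₁ u₂ : EuclideanSpace ℝ (Fin N) → ℝ,
        AnisotropicComparison.IsWeakSolution Ω p F φ u₁ →
        AnisotropicComparison.IsWeakSolution Ω p F φ u₂ →
        ∀ᵐ x ∂(volume.restrict Ω), u₁ x = u₂ x)) := by
  have hne := AnisotropicComparison.nonempty_compl_of_isBounded hN hΩb
  refine ⟨fun u₁ u₂ z₁ z₂ hu₁ hu₂ hz₁ hz₂ hdiv hle =>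
    AnisotropicComparison.comparison hN hp hΩ hΩb hne hΩL hF hu₁ hu₂ hz₁ hz₂ hdiv hle,
    fun φ ⟨v, hv⟩ => ⟨fun u₁ u₂ h₁ h₂ => ?_, fun u₁ u₂ h₁ h₂ => ?_⟩⟩
  · have ht₁ := h₁.hasTrace hp hv
    have ht₂ := h₂.hasTrace hp hv
    have hgrad := h₁.weakGrad_ae_eq hp hΩ hΩb hF ht₁ ht₂ h₂
    have a₁ := AnisotropicComparison.ae_le_of_leOnBoundary hN hp hΩ hΩb hne hΩL
      (ht₁.leOnBoundary ht₂) (hgrad.mono fun _ h _ => h)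
    have a₂ := AnisotropicComparison.ae_le_of_leOnBoundary hN hp hΩ hΩb hne hΩL
      (ht₂.leOnBoundary ht₁) (hgrad.mono fun _ h _ => h.symm)
    filter_upwards [a₁, a₂] with x h1 h2 using le_antisymm h1 h2
  · obtain ⟨ht₁, z₁, hz₁, hw₁⟩ := h₁
    obtain ⟨ht₂, z₂, hz₂, hw₂⟩ := h₂
    -- Both fluxes integrate to zero against every test function, so the divergence inequality holds
    -- in both directions.
    have a₁ := AnisotropicComparison.comparison hN hp hΩ hΩb hne hΩL hF ht₁.1 ht₂.1 hz₁ hz₂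
      (fun w hw _ => by rw [hw₁ w hw, hw₂ w hw]) (ht₁.leOnBoundary ht₂)
    have a₂ := AnisotropicComparison.comparison hN hp hΩ hΩb hne hΩL hF ht₂.1 ht₁.1 hz₂ hz₁
      (fun w hw _ => by rw [hw₁ w hw, hw₂ w hw]) (ht₂.leOnBoundary ht₁)
    filter_upwards [a₁, a₂] with x h1 h2 using le_antisymm h1 h2
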